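/- Let $R=\bigoplus_{n\ge 0}R_n$ be a graded commutative Noetherian ring whose base ring $R_0$ is local with maximal ideal $\mathfrak m_0$. Let $\mathfrak a_0,\mathfrak b_0$ be ideals of $R_0$ with $\sqrt{\mathfrak a_0+\mathfrak b_0}=\mathfrak m_0$, put $R_+=\bigoplus_{n>0}R_n$ and $\mathfrak a=\mathfrak a_0R+R_+$. Let $T=\bigoplus_{n\in\mathbb Z}T_n$ be a graded $R$-module which is $\mathfrak a$-torsion (every element of $T$ is annihilated by some power of $\mathfrak a$) and minimax (there is a finitely generated $R$-submodule $L\subseteq T$ such that $T/L$ is an Artinian $R$-module). Then, for every $i\ge 0$, the modules $H^i_{\mathfrak b_0}(T)$ and $\operatorname{Tor}_i^{R_0}(R_0/\mathfrak b_0,T)$ are Artinian $R$-modules. Here $H^i_{\mathfrak b_0}(T)=\varinjlim_n \operatorname{Ext}^i_{R_0}(R_0/\mathfrak b_0^n,T)$, and this module and $\operatorname{Tor}_i^{R_0}(R_0/\mathfrak b_0,T)$ carry the $R$-module structure induced by the $R_0$-linear action of $R$ on $T$. The assertion on local cohomology also holds for $H^i_{\mathfrak b_0R}(T)=\varinjlim_n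 \operatorname{Ext}^i_{R}(R/(\mathfrak b_0R)^n,T)$, formed over $R$. -/

import Mathlib

universe u

open CategoryTheory CategoryTheory.Limits Opposite

namespace GradedMinimax

section Additivity

variable {C D : Type*} [Category* C] [Category* D]

/-- Taking left derived natural transformations is additive. -/
theorem leftDerived_app_add [Abelian C] [HasProjectiveResolutions C] [Abelian D]
    {F G : C ⥤ D} [F.Additive] [G.Additive] (α β : F ⟶ G) (n : ℕ) (X : C) :
    (NatTrans.leftDerived (α + β) n).app X =
      (NatTrans.leftDerived α n).app X + (NatTrans.leftDerived β n).app X := by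
  let P := projectiveResolution X
  rw [P.leftDerived_app_eq, P.leftDerived_app_eq, P.leftDerived_app_eq]
  have h : (NatTrans.mapHomologicalComplex (α + β) (ComplexShape.down ℕ)).app P.complex =
      (NatTrans.mapHomologicalComplex α (ComplexShape.down ℕ)).app P.complex +
        (NatTrans.mapHomologicalComplex β (ComplexShape.down ℕ)).app P.complex := by
    ext i
    rfl
  rw [h, Functor.map_add, Preadditive.add_comp, Preadditive.comp_add]

end Additivity

section Functors

variable {S : Type u} [CommRing S]

instance tor'_obj_additive (X : ModuleCat.{u} S) (n : ℕ) :
    ((Tor' (ModuleCat.{u} S) n).obj X).Additive where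
  map_add {Y Z f g} := by
    have h : (MonoidalCategory.tensoringRight (ModuleCat.{u} S)).map (f + g) =
        (MonoidalCategory.tensoringRight (ModuleCat.{u} S)).map f +
          (MonoidalCategory.tensoringRight (ModuleCat.{u} S)).map g := by
      ext W : 2
      exact (MonoidalCategory.tensorLeft (W : ModuleCat.{u} S)).map_add (f := f) (g := g)
    change (NatTrans.leftDerived
      ((MonoidalCategory.tensoringRight (ModuleCat.{u} S)).map (f + g)) n).app X = _
    rw [h]
    exact leftDerived_app_add _ _ n X

instance ext_obj_additive (X : (ModuleCat.{u} S)ᵒᵖ) (n : ℕ) :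
    ((Ext S (ModuleCat.{u} S) n).obj X).Additive where
  map_add {Y Z f g} := by
    have h : NatTrans.rightOp ((linearYoneda S (ModuleCat.{u} S)).map (f + g)) =
        NatTrans.rightOp ((linearYoneda S (ModuleCat.{u} S)).map f) +
          NatTrans.rightOp ((linearYoneda S (ModuleCat.{u} S)).map g) := by
      ext W : 2
      apply Quiver.Hom.unop_inj
      ext φ
      exact Preadditive.comp_add _ _ _ φ f g
    change ((NatTrans.leftDerived (NatTrans.rightOp
        ((linearYoneda S (ModuleCat.{u} S)).map (f + g))) n).app X.unop).unop = _
    rw [h, leftDerived_app_add]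
    rfl

instance localCohomology_additive (J : Ideal S) (n : ℕ) :
    (localCohomology J n).Additive where
  map_add {Y Z f g} := by
    let G := localCohomology.diagram (localCohomology.idealPowersDiagram J) n
    have hG : ∀ j, (G.obj j).Additive := fun j => ext_obj_additive _ n
    change (colimit G).map (f + g) = (colimit G).map f + (colimit G).map g
    refine (isColimitOfPreserves ((evaluation _ _).obj Y) (colimit.isColimit G)).hom_ext
      fun j => ?_
    change (colimit.ι G j).app Y ≫ _ = (colimit.ι G j).app Y ≫ _
    rw [Preadditive.comp_add, ← NatTrans.naturality, ← NatTrans.naturality,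
      ← NatTrans.naturality, (hG j).map_add, Preadditive.add_comp]

end Functors

section InducedModule

variable {S R : Type u} [CommRing S] [CommRing R] [Algebra S R]

/-- An `R`-module `T` regarded as an `S`-module, for an `S`-algebra `R`. -/
noncomputable abbrev restrict (S : Type u) {R : Type u} [CommRing S] [CommRing R] [Algebra S R]
    (T : ModuleCat.{u} R) : ModuleCat.{u} S :=
  (ModuleCat.restrictScalars (algebraMap S R)).obj T

/-- Multiplication by `r : R` on an `R`-module `T`, as an `S`-linear endomorphism of `T`. -/
noncomputable def mulHom (S : Type u) {R : Type u} [CommRing S] [CommRing R] [Algebra S R]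
    (T : ModuleCat.{u} R) (r : R) : restrict S T ⟶ restrict S T :=
  (ModuleCat.restrictScalars (algebraMap S R)).map
    (ModuleCat.ofHom (r • (LinearMap.id : T →ₗ[R] T)))

theorem mulHom_apply (T : ModuleCat.{u} R) (r : R) (t : T) :
    (mulHom S T r).hom t = (r • t : T) := rfl

theorem mulHom_one (T : ModuleCat.{u} R) : mulHom S T 1 = 𝟙 _ := by
  ext t; exact one_smul R (t : T)

theorem mulHom_mul (T : ModuleCat.{u} R) (r s : R) :
    mulHom S T (r * s) = mulHom S T s ≫ mulHom S T r := by
  ext t; exact mul_smul r s (t : T)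

theorem mulHom_add (T : ModuleCat.{u} R) (r s : R) :
    mulHom S T (r + s) = mulHom S T r + mulHom S T s := by
  ext t; exact add_smul r s (t : T)

theorem mulHom_zero (T : ModuleCat.{u} R) : mulHom S T 0 = 0 := by
  ext t; exact zero_smul R (t : T)

/-- For an additive functor `F` on `S`-modules and a module `T` over an `S`-algebra `R`, the
natural `R`-module structure on `F(T)`: an element `r : R` acts as `F(r)`, the image under `F` of
multiplication by `r` on `T`. -/
@[reducible]
noncomputable def inducedModuleStructure (F : ModuleCat.{u} S ⥤ ModuleCat.{u} S) [F.Additive]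
    (T : ModuleCat.{u} R) : Module R (F.obj (restrict S T)) where
  smul r y := (F.map (mulHom S T r)).hom y
  one_smul y := by
    change (F.map (mulHom S T 1)).hom y = y
    rw [mulHom_one, F.map_id]; rfl
  mul_smul r s y := by
    change (F.map (mulHom S T (r * s))).hom y =
      (F.map (mulHom S T r)).hom ((F.map (mulHom S T s)).hom y)
    rw [mulHom_mul, F.map_comp]; rfl
  smul_zero r := map_zero (F.map (mulHom S T r)).hom
  smul_add r y z := map_add (F.map (mulHom S T r)).hom y z
  add_smul r s y := by
    change (F.map (mulHom S T (r + s))).hom y =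
      (F.map (mulHom S T r)).hom y + (F.map (mulHom S T s)).hom y
    rw [mulHom_add, F.map_add]; rfl
  zero_smul y := by
    change (F.map (mulHom S T 0)).hom y = 0
    rw [mulHom_zero, F.map_zero]; rfl

/-- `F(T)` with its natural `R`-module structure. -/
noncomputable def inducedModule (F : ModuleCat.{u} S ⥤ ModuleCat.{u} S) [F.Additive]
    (T : ModuleCat.{u} R) : ModuleCat.{u} R :=
  letI := inducedModuleStructure F T
  ModuleCat.of R (F.obj (restrict S T))

end InducedModule

/-- The local cohomology module `H^i_J(T) = colim_n Ext^i_S(S/J^n, T)` of a module `T` over an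
`S`-algebra `R`, with respect to an ideal `J` of `S`, with its natural `R`-module structure. -/
noncomputable def localCohomologyOver {S R : Type u} [CommRing S] [CommRing R] [Algebra S R]
    (J : Ideal S) (i : ℕ) (T : ModuleCat.{u} R) : ModuleCat.{u} R :=
  inducedModule (localCohomology J i) T

/-- `Tor_i^S(S/J, T)` for a module `T` over an `S`-algebra `R` and an ideal `J` of `S`, with its
natural `R`-module structure. Here `Tor'` is Mathlib's `Tor` computed from a projective resolution
of the first argument. -/
noncomputable def torOver {S R : Type u} [CommRing S] [CommRing R] [Algebra S R]
    (J : Ideal S) (i : ℕ) (T : ModuleCat.{u} R) : ModuleCat.{u} R :=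
  inducedModule ((Tor' (ModuleCat.{u} S) i).obj (ModuleCat.of S (S ⧸ J))) T

/-- `T` is the direct sum of the additive subgroups `ℳ n`, `n : ℤ`, and
`R_m · T_n ⊆ T_{m+n}`. -/
structure IsGradedModule {R : Type*} [CommRing R] (𝒜 : ℕ → AddSubgroup R)
    {T : Type*} [AddCommGroup T] [Module R T] (ℳ : ℤ → AddSubgroup T) : Prop where
  isInternal : DirectSum.IsInternal ℳ
  smul_mem : ∀ (m : ℕ) (n : ℤ) (r : R) (t : T), r ∈ 𝒜 m → t ∈ ℳ n → r • t ∈ ℳ ((m : ℤ) + n)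

/-- `T` is `I`-torsion: every element is annihilated by a power of `I`. -/
def IsPowTorsion {R : Type*} [CommRing R] (I : Ideal R)
    (T : Type*) [AddCommGroup T] [Module R T] : Prop :=
  ∀ t : T, ∃ n : ℕ, ∀ x ∈ I ^ n, x • t = 0

/-- `T` is minimax: it has a finitely generated submodule with Artinian quotient. -/
def IsMinimax (R : Type*) [CommRing R] (T : Type*) [AddCommGroup T] [Module R T] : Prop :=
  ∃ L : Submodule R T, L.FG ∧ IsArtinian R (T ⧸ L)

/-- The ideal `I₀R + R₊` of a graded ring `R = ⨁_{n ≥ 0} R_n`, for an ideal `I₀` of `R₀`. -/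
noncomputable def extendAddIrrelevant {R : Type*} [CommRing R] (𝒜 : ℕ → AddSubgroup R)
    [GradedRing 𝒜] (I₀ : Ideal (𝒜 0)) : Ideal R :=
  I₀.map (algebraMap (𝒜 0) R) ⊔ (HomogeneousIdeal.irrelevant 𝒜).toIdeal

end GradedMinimax

/-! Write `a = a₀R + R₊` and `J = b₀`. The grading of `R` enters through two facts: a prime
containing `a` and `JR` is maximal, and a maximal ideal containing `a` contains `JR`. Both come from
`R₀ → R/P` being surjective once `R₊ ⊆ P`: contraction to `R₀` then preserves and reflects
maximality, and `√(a₀ + b₀)` is the only maximal ideal of `R₀`. The rest is proved for an algebra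
`R` over a ring `S`, both Noetherian.

Local cohomology. Choose `L ⊆ T` finitely generated with `T/L` Artinian; it suffices to treat `L`
and `T/L`. The quotient is `a`-torsion and Artinian, hence `JR`-torsion, so its `H^0` is a copy of
itself and its higher local cohomology vanishes (`localCohomology_succ_eq_zero_of_isPowTorsion`,
resting on Artin–Rees through `baer_powTorsion`). For `L`, induct on `i`
(`isArtinian_lc_of_finite`). In degree 0, the `JR`-torsion of `L` is finitely generated and killed
by powers of `a` and `JR`, so it is Artinian. In higher degree, dividing out this torsion makes some
`x ∈ J` regular; the kernel of `x` on `H^{i+1}` is then an image of `H^i(L/xL)`, Artinian by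
induction, and since `H^{i+1}` is `x`-torsion, Melkersson's criterion
`isArtinian_of_isArtinian_ker_smul` applies.

Tor. With `S/J` resolved by finitely generated projectives, `Tor_i` is a subquotient of some `T^n`,
hence minimax and `a`-torsion. It is also killed by `J`, and these properties together force it to
be Artinian (`IsMinimax.isArtinian`).

The `R`-action on these `S`-modules comes from functoriality, so classes are represented by explicit
cocycles. The connecting homomorphism and the identification of `H^0` appear as relations; being
additive and natural, they are `R`-submodules of products, which is enough to transfer the Artinian
property (`isArtinian_of_relation`). -/

namespace GradedMinimax

/-! ### Homology classes of cycles in complexes of modules. -/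

section HomologyClasses

variable {S : Type u} [Ring S] {ι : Type*} {c : ComplexShape ι}

/-- The class in homology of a cycle of a complex of modules. -/
noncomputable def homologyClass (K : HomologicalComplex (ModuleCat.{u} S) c) (i : ι) :
    LinearMap.ker (K.d i (c.next i)).hom →ₗ[S] K.homology i :=
  ((K.sc i).moduleCatCyclesIso.inv ≫ (K.sc i).homologyπ).hom

theorem homologyClass_surjective (K : HomologicalComplex (ModuleCat.{u} S) c) (i : ι) :
    Function.Surjective (homologyClass K i) :=
  (ModuleCat.epi_iff_surjective
    ((K.sc i).moduleCatCyclesIso.inv ≫ (K.sc i).homologyπ)).1 inferInstance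

theorem homologyClass_eq_zero_iff (K : HomologicalComplex (ModuleCat.{u} S) c) (i : ι)
    (x : LinearMap.ker (K.d i (c.next i)).hom) :
    homologyClass K i x = 0 ↔ ∃ y, (K.d (c.prev i) i).hom y = x := by
  have h := ConcreteCategory.congr_hom (K.sc i).moduleCatCyclesIso_inv_π x
  have hi : Function.Injective (K.sc i).moduleCatHomologyIso.inv.hom :=
    (ModuleCat.mono_iff_injective _).1 inferInstance
  have h' : homologyClass K i x = 0 ↔
      x ∈ LinearMap.range (K.sc i).moduleCatToCycles := by
    refine Iff.trans ?_ (Submodule.Quotient.mk_eq_zero _)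
    change ((K.sc i).moduleCatCyclesIso.inv ≫ (K.sc i).homologyπ).hom x = 0 ↔ _
    exact ⟨fun h0 => hi ((h.symm.trans h0).trans (map_zero _).symm),
      fun h0 => h.trans ((congrArg (K.sc i).moduleCatHomologyIso.inv.hom h0).trans (map_zero _))⟩
  rw [h']
  constructor
  · rintro ⟨y, hy⟩
    exact ⟨y, congrArg Subtype.val hy⟩
  · rintro ⟨y, hy⟩
    exact ⟨y, Subtype.ext hy⟩

theorem homologyMap_homologyClass {K L : HomologicalComplex (ModuleCat.{u} S) c} (f : K ⟶ L)
    (i : ι) (x : LinearMap.ker (K.d i (c.next i)).hom) (y : LinearMap.ker (L.d i (c.next i)).hom)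
    (hxy : (f.f i).hom x.1 = y.1) :
    (HomologicalComplex.homologyMap f i).hom (homologyClass K i x) = homologyClass L i y := by
  have h1 : (HomologicalComplex.cyclesMap f i).hom ((K.sc i).moduleCatCyclesIso.inv.hom x) =
      (L.sc i).moduleCatCyclesIso.inv.hom y := by
    apply (ModuleCat.mono_iff_injective (L.sc i).iCycles).1 inferInstance
    have h2 := ConcreteCategory.congr_hom (HomologicalComplex.cyclesMap_i f i)
      ((K.sc i).moduleCatCyclesIso.inv.hom x)
    have h3 := ConcreteCategory.congr_hom (K.sc i).moduleCatCyclesIso_inv_iCycles x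
    have h4 := ConcreteCategory.congr_hom (L.sc i).moduleCatCyclesIso_inv_iCycles y
    refine Eq.trans h2 (Eq.trans ?_ h4.symm)
    change (f.f i).hom ((K.sc i).iCycles.hom ((K.sc i).moduleCatCyclesIso.inv.hom x)) = _
    exact (congrArg (f.f i).hom h3).trans hxy
  have h5 := ConcreteCategory.congr_hom (HomologicalComplex.homologyπ_naturality f i)
    ((K.sc i).moduleCatCyclesIso.inv.hom x)
  refine Eq.trans h5 ?_
  exact congrArg (L.sc i).homologyπ.hom h1

end HomologyClasses

/-! ### Ext classes as cocycles on a projective resolution. -/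

section ExtClasses

variable {S : Type u} [CommRing S]

/-- The map on complexes of morphisms induced by a morphism of complexes and a morphism of
modules. -/
noncomputable def yonedaMap {K L : ChainComplex (ModuleCat.{u} S) ℕ} (g : L ⟶ K)
    {M N : ModuleCat.{u} S} (f : M ⟶ N) :
    K.linearYonedaObj S M ⟶ L.linearYonedaObj S N where
  f i := ModuleCat.ofHom
    { toFun := fun φ : K.X i ⟶ M => (g.f i ≫ φ ≫ f : L.X i ⟶ N)
      map_add' := fun φ ψ : K.X i ⟶ M => by
        change g.f i ≫ (φ + ψ) ≫ f = g.f i ≫ φ ≫ f + g.f i ≫ ψ ≫ f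
        simp
      map_smul' := fun r (φ : K.X i ⟶ M) => by
        change g.f i ≫ (r • φ) ≫ f = r • (g.f i ≫ φ ≫ f)
        simp }
  comm' i j _ := by
    apply ModuleCat.hom_ext
    apply LinearMap.ext
    intro (φ : K.X i ⟶ M)
    change L.d j i ≫ g.f i ≫ φ ≫ f = g.f j ≫ (K.d j i ≫ φ) ≫ f
    simp

variable {X : ModuleCat.{u} S} (P : ProjectiveResolution X)

theorem inv_square {C : Type*} [Category* C] {A A' B B' : C} (eA : A' ≅ A) (eB : B' ≅ B)
    (f : A ⟶ B) (f' : A' ⟶ B') (h : f' ≫ eB.hom = eA.hom ≫ f) :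
    f ≫ eB.inv = eA.inv ≫ f' := by
  rw [Iso.comp_inv_eq, Category.assoc, h, Iso.inv_hom_id_assoc]

/-- `Ext` is the opposite of a left derived functor with values in an opposite category, so its
comparison with cohomology of the Hom complex has two stages; this glues their naturality squares.
-/
theorem unop_square {C : Type*} [Category* C] {A A' B B' : Cᵒᵖ} {H K : C} (eA : A ≅ A')
    (eB : B ≅ B') (l : A ⟶ B) (m : A' ⟶ B') (hl : l ≫ eB.hom = eA.hom ≫ m)
    (kA : unop A' ≅ K) (kB : unop B' ≅ H) (w : H ⟶ K) (h : m.unop ≫ kA.hom = kB.hom ≫ w) :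
    l.unop ≫ (eA.unop.symm ≪≫ kA).hom = (eB.unop.symm ≪≫ kB).hom ≫ w := by
  have hl' : l.unop ≫ eA.inv.unop = eB.inv.unop ≫ m.unop := by
    exact congrArg Quiver.Hom.unop (inv_square eA eB m l hl).symm
  simp only [Iso.trans_hom, Iso.symm_hom, Iso.unop_inv, Category.assoc, ← h]
  rw [← Category.assoc, hl', Category.assoc]

theorem homologyUnop_inv_naturality {K L : ChainComplex (ModuleCat.{u} S)ᵒᵖ ℕ} (ψ : K ⟶ L)
    (i : ℕ) :
    (HomologicalComplex.homologyMap ψ i).unop ≫ (K.homologyUnop i).inv =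
      (L.homologyUnop i).inv ≫ HomologicalComplex.homologyMap
        ((HomologicalComplex.unopFunctor _ _).map ψ.op) i := by
  have h := HomologicalComplex.homologyOp_hom_naturality
    ((HomologicalComplex.unopFunctor _ _).map ψ.op) i
  have h' := congrArg Quiver.Hom.unop h
  exact inv_square (L.homologyUnop i) (K.homologyUnop i) _ _ h'.symm

theorem isoExt_hom_naturality_right (i : ℕ) {M N : ModuleCat.{u} S} (f : M ⟶ N) :
    ((Ext S (ModuleCat.{u} S) i).obj (op X)).map f ≫ (P.isoExt (R := S) i N).hom =
      (P.isoExt (R := S) i M).hom ≫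
        HomologicalComplex.homologyMap (yonedaMap (𝟙 P.complex) f) i := by
  have h1 := P.leftDerived_app_eq (NatTrans.rightOp ((linearYoneda S (ModuleCat.{u} S)).map f)) i
  have h2 := homologyUnop_inv_naturality ((NatTrans.mapHomologicalComplex
    (NatTrans.rightOp ((linearYoneda S (ModuleCat.{u} S)).map f)) (ComplexShape.down ℕ)).app
      P.complex) i
  have h3 : (HomologicalComplex.unopFunctor _ _).map ((NatTrans.mapHomologicalComplex
    (NatTrans.rightOp ((linearYoneda S (ModuleCat.{u} S)).map f)) (ComplexShape.down ℕ)).app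
      P.complex).op = yonedaMap (𝟙 P.complex) f := by
    ext j φ
    exact (Category.id_comp (X := P.complex.X j) ((show P.complex.X j ⟶ M from φ) ≫ f)).symm
  rw [h3] at h2
  exact unop_square (P.isoLeftDerivedObj ((linearYoneda S (ModuleCat.{u} S)).obj N).rightOp i)
    (P.isoLeftDerivedObj ((linearYoneda S (ModuleCat.{u} S)).obj M).rightOp i)
    ((NatTrans.leftDerived
      (NatTrans.rightOp ((linearYoneda S (ModuleCat.{u} S)).map f)) i).app X) _
    (by rw [h1, Category.assoc, Category.assoc, Iso.inv_hom_id, Category.comp_id]; rfl)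
    (HomologicalComplex.homologyUnop _ _).symm (HomologicalComplex.homologyUnop _ _).symm _ h2

theorem isoExt_hom_naturality_left (i : ℕ) {Y : ModuleCat.{u} S} (Q : ProjectiveResolution Y)
    (g : Y ⟶ X) (G : Q.complex ⟶ P.complex) (h : G.f 0 ≫ P.π.f 0 = Q.π.f 0 ≫ g)
    (M : ModuleCat.{u} S) :
    ((Ext S (ModuleCat.{u} S) i).map g.op).app M ≫ (Q.isoExt (R := S) i M).hom =
      (P.isoExt (R := S) i M).hom ≫ HomologicalComplex.homologyMap (yonedaMap G (𝟙 M)) i := by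
  have h1 := Q.isoLeftDerivedObj_hom_naturality g P G h
    ((linearYoneda S (ModuleCat.{u} S)).obj M).rightOp i
  have h2 := homologyUnop_inv_naturality
    ((((linearYoneda S (ModuleCat.{u} S)).obj M).rightOp.mapHomologicalComplex _).map G) i
  have h3 : (HomologicalComplex.unopFunctor _ _).map ((((linearYoneda S
      (ModuleCat.{u} S)).obj M).rightOp.mapHomologicalComplex _).map G).op =
        yonedaMap G (𝟙 M) := by
    ext j φ
    exact congrArg (G.f j ≫ ·) (Category.comp_id (show P.complex.X j ⟶ M from φ)).symm
  rw [h3] at h2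
  exact unop_square _ _ _ _ h1 (HomologicalComplex.homologyUnop _ _).symm
    (HomologicalComplex.homologyUnop _ _).symm _ h2

theorem iso_hom_inv_apply {M N : ModuleCat.{u} S} (e : M ≅ N) (x : N) :
    e.hom.hom (e.inv.hom x) = x :=
  ConcreteCategory.congr_hom e.inv_hom_id x

theorem linearYonedaObj_cocycle {i : ℕ} {M : ModuleCat.{u} S} {φ : P.complex.X i ⟶ M}
    (h : P.complex.d (i + 1) i ≫ φ = 0) :
    φ ∈ LinearMap.ker ((P.complex.linearYonedaObj S M).d i
      ((ComplexShape.up ℕ).next i)).hom := by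
  rw [show (ComplexShape.up ℕ).next i = i + 1 from ComplexShape.next_eq' _ rfl]
  exact h

/-- The class in `Ext^i(X, M)` of an `i`-cocycle on a projective resolution of `X`. -/
noncomputable def extMk {i : ℕ} {M : ModuleCat.{u} S} (φ : P.complex.X i ⟶ M)
    (h : P.complex.d (i + 1) i ≫ φ = 0) : ((Ext S (ModuleCat.{u} S) i).obj (op X)).obj M :=
  (P.isoExt (R := S) i M).inv.hom
    (homologyClass (P.complex.linearYonedaObj S M) i ⟨φ, linearYonedaObj_cocycle P h⟩)

theorem exists_extMk {i : ℕ} {M : ModuleCat.{u} S}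
    (y : ((Ext S (ModuleCat.{u} S) i).obj (op X)).obj M) :
    ∃ (φ : P.complex.X i ⟶ M) (h : P.complex.d (i + 1) i ≫ φ = 0), extMk P φ h = y := by
  obtain ⟨⟨φ, hφ⟩, e⟩ := homologyClass_surjective _ _ ((P.isoExt (R := S) i M).hom.hom y)
  have h : P.complex.d (i + 1) i ≫ φ = 0 := by
    rw [show (ComplexShape.up ℕ).next i = i + 1 from ComplexShape.next_eq' _ rfl] at hφ
    exact hφ
  refine ⟨φ, h, (congrArg (P.isoExt (R := S) i M).inv.hom e).trans ?_⟩
  exact iso_hom_inv_apply (P.isoExt (R := S) i M).symm y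

theorem isoExt_hom_extMk {i : ℕ} {M : ModuleCat.{u} S} (φ : P.complex.X i ⟶ M)
    (h : P.complex.d (i + 1) i ≫ φ = 0) : (P.isoExt (R := S) i M).hom.hom (extMk P φ h) =
      homologyClass (P.complex.linearYonedaObj S M) i ⟨φ, linearYonedaObj_cocycle P h⟩ :=
  iso_hom_inv_apply (P.isoExt (R := S) i M) _

theorem isoExt_hom_injective (i : ℕ) (M : ModuleCat.{u} S) :
    Function.Injective (P.isoExt (R := S) i M).hom.hom :=
  (ModuleCat.mono_iff_injective _).1 inferInstance

/-- Taking `j = next i` treats all degrees at once: for `i = 0` the default is `j = 0` with zero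
differential, so the only coboundary is `0`. -/
theorem extMk_eq_zero_iff {i j : ℕ} (hj : (ComplexShape.down ℕ).next i = j)
    {M : ModuleCat.{u} S} (φ : P.complex.X i ⟶ M)
    (h : P.complex.d (i + 1) i ≫ φ = 0) :
    extMk P φ h = 0 ↔ ∃ ψ : P.complex.X j ⟶ M, P.complex.d i j ≫ ψ = φ := by
  rw [← (isoExt_hom_injective P i M).eq_iff, map_zero, isoExt_hom_extMk,
    homologyClass_eq_zero_iff]
  subst hj
  rfl

theorem extMk_zero_eq_zero_iff {M : ModuleCat.{u} S} (φ : P.complex.X 0 ⟶ M)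
    (h : P.complex.d 1 0 ≫ φ = 0) : extMk P φ h = 0 ↔ φ = 0 := by
  rw [extMk_eq_zero_iff P (j := 0) (by simp)]
  simp [eq_comm]

theorem extMk_succ_eq_zero_iff {i : ℕ} {M : ModuleCat.{u} S} (φ : P.complex.X (i + 1) ⟶ M)
    (h : P.complex.d (i + 2) (i + 1) ≫ φ = 0) :
    extMk P φ h = 0 ↔ ∃ ψ : P.complex.X i ⟶ M, P.complex.d (i + 1) i ≫ ψ = φ :=
  extMk_eq_zero_iff P (by simp) φ h

theorem extMk_add {i : ℕ} {M : ModuleCat.{u} S} (φ ψ : P.complex.X i ⟶ M)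
    (h : P.complex.d (i + 1) i ≫ φ = 0) (h' : P.complex.d (i + 1) i ≫ ψ = 0) :
    extMk P (φ + ψ) (by rw [Preadditive.comp_add, h, h', add_zero]) =
      extMk P φ h + extMk P ψ h' := by
  unfold extMk
  rw [← map_add, ← map_add]
  rfl

theorem extMk_smul {i : ℕ} {M : ModuleCat.{u} S} (r : S) (φ : P.complex.X i ⟶ M)
    (h : P.complex.d (i + 1) i ≫ φ = 0) :
    extMk P (r • φ) (by rw [Linear.comp_smul, h, smul_zero]) = r • extMk P φ h := by
  unfold extMk
  rw [← map_smul, ← map_smul]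
  rfl

theorem ext_map_right_extMk {i : ℕ} {M N : ModuleCat.{u} S} (f : M ⟶ N)
    (φ : P.complex.X i ⟶ M) (h : P.complex.d (i + 1) i ≫ φ = 0) :
    (((Ext S (ModuleCat.{u} S) i).obj (op X)).map f).hom (extMk P φ h) =
      extMk P (φ ≫ f) (by rw [← Category.assoc, h, zero_comp]) := by
  apply isoExt_hom_injective P
  refine (ConcreteCategory.congr_hom (isoExt_hom_naturality_right P i f) (extMk P φ h)).trans ?_
  refine (congrArg (HomologicalComplex.homologyMap (yonedaMap (𝟙 P.complex) f) i).hom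
    (isoExt_hom_extMk P φ h)).trans ?_
  rw [isoExt_hom_extMk]
  exact homologyMap_homologyClass _ _ _ _ (Category.id_comp (φ ≫ f))

theorem ext_map_left_extMk {i : ℕ} {Y : ModuleCat.{u} S} (Q : ProjectiveResolution Y)
    (g : Y ⟶ X) (G : Q.complex ⟶ P.complex) (hG : G.f 0 ≫ P.π.f 0 = Q.π.f 0 ≫ g)
    {M : ModuleCat.{u} S} (φ : P.complex.X i ⟶ M) (h : P.complex.d (i + 1) i ≫ φ = 0) :
    (((Ext S (ModuleCat.{u} S) i).map g.op).app M).hom (extMk P φ h) =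
      extMk Q (G.f i ≫ φ) (by rw [← Category.assoc, ← G.comm, Category.assoc, h, comp_zero]) := by
  apply isoExt_hom_injective Q
  refine (ConcreteCategory.congr_hom (isoExt_hom_naturality_left P i Q g G hG M)
    (extMk P φ h)).trans ?_
  refine (congrArg (HomologicalComplex.homologyMap (yonedaMap G (𝟙 M)) i).hom
    (isoExt_hom_extMk P φ h)).trans ?_
  rw [isoExt_hom_extMk]
  exact homologyMap_homologyClass _ _ _ _ (congrArg (G.f i ≫ ·) (Category.comp_id φ))

end ExtClasses

theorem extMk_zero {S : Type u} [CommRing S] {X : ModuleCat.{u} S} (P : ProjectiveResolution X)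
    {i : ℕ} {M : ModuleCat.{u} S} :
    extMk P (0 : P.complex.X i ⟶ M) comp_zero = 0 :=
  (extMk_eq_zero_iff P rfl _ _).2 ⟨0, comp_zero⟩

/-! ### Local cohomology classes represented by cocycles. -/

section LocalCohomologyClasses

variable {S : Type u} [CommRing S] (J : Ideal S)

/-- A projective resolution of `S/J^n`. -/
noncomputable abbrev powRes (n : ℕ) :
    ProjectiveResolution (ModuleCat.of S (S ⧸ J ^ n)) :=
  projectiveResolution _

/-- The projection `S/J^n ⟶ S/J^m` for `m ≤ n`. -/
noncomputable abbrev powProj {m n : ℕ} (h : m ≤ n) :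
    ModuleCat.of S (S ⧸ J ^ n) ⟶ ModuleCat.of S (S ⧸ J ^ m) :=
  ModuleCat.ofHom (Submodule.mapQ _ _ LinearMap.id (Ideal.pow_le_pow_right h))

/-- A lift of the projection `S/J^n ⟶ S/J^m` to projective resolutions. -/
noncomputable def powLift {m n : ℕ} (h : m ≤ n) :
    (powRes J n).complex ⟶ (powRes J m).complex :=
  ProjectiveResolution.lift (powProj J h) _ _

theorem powLift_comm {m n : ℕ} (h : m ≤ n) :
    (powLift J h).f 0 ≫ (powRes J m).π.f 0 = (powRes J n).π.f 0 ≫ powProj J h :=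
  ProjectiveResolution.lift_commutes_zero _ _ _

theorem powLift_cocycle {m n : ℕ} (hmn : m ≤ n) {i : ℕ} {M : ModuleCat.{u} S}
    {φ : (powRes J m).complex.X i ⟶ M} (h : (powRes J m).complex.d (i + 1) i ≫ φ = 0) :
    (powRes J n).complex.d (i + 1) i ≫ (powLift J hmn).f i ≫ φ = 0 := by
  rw [← Category.assoc, ← (powLift J hmn).comm, Category.assoc, h, comp_zero]

theorem cocycle_comp {X : ModuleCat.{u} S} (P : ProjectiveResolution X) {i : ℕ}
    {M N : ModuleCat.{u} S} {φ : P.complex.X i ⟶ M} (h : P.complex.d (i + 1) i ≫ φ = 0)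
    (f : M ⟶ N) : P.complex.d (i + 1) i ≫ φ ≫ f = 0 := by
  rw [← Category.assoc, h, zero_comp]

/-- The index category of the Ext diagram; filteredness lets elements of the colimit, and their
vanishing, be detected at a finite stage. -/
instance isFiltered_nat_op_op : IsFiltered ℕᵒᵖᵒᵖ := isFiltered_op_of_isCofiltered _

/-- The canonical map `Ext^i(S/J^n, M) → H^i_J(M)`. -/
noncomputable def lcι (i n : ℕ) (M : ModuleCat.{u} S) :
    ((Ext S (ModuleCat.{u} S) i).obj (op (ModuleCat.of S (S ⧸ J ^ n)))).obj M →ₗ[S]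
      (localCohomology J i).obj M :=
  ((colimit.ι (localCohomology.diagram (localCohomology.idealPowersDiagram J) i)
    (op (op n))).app M).hom

/-- The class in `H^i_J(M)` of a cocycle on a resolution of `S/J^n`. -/
noncomputable def lcMk {i : ℕ} (n : ℕ) {M : ModuleCat.{u} S}
    (φ : (powRes J n).complex.X i ⟶ M) (h : (powRes J n).complex.d (i + 1) i ≫ φ = 0) :
    (localCohomology J i).obj M :=
  lcι J i n M (extMk (powRes J n) φ h)

variable {J} {i : ℕ} {M N : ModuleCat.{u} S}

/-- Local cohomology of a fixed module as a colimit of `Ext` modules. -/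
noncomputable def localCohomologyIsColimit (J : Ideal S) (i : ℕ) (M : ModuleCat.{u} S) :
    IsColimit (((evaluation _ _).obj M).mapCocone (colimit.cocone
      (localCohomology.diagram (localCohomology.idealPowersDiagram J) i))) :=
  isColimitOfPreserves ((evaluation _ _).obj M) (colimit.isColimit _)

theorem preservesColimit_forget (J : Ideal S) (i : ℕ) (M : ModuleCat.{u} S) :
    PreservesColimit (localCohomology.diagram (localCohomology.idealPowersDiagram J) i ⋙
      (evaluation (ModuleCat.{u} S) (ModuleCat.{u} S)).obj M) (forget (ModuleCat.{u} S)) :=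
  have := preservesFilteredColimitsOfSize_shrink.{0, u, 0, u} (forget (ModuleCat.{u} S))
  inferInstance

theorem exists_lcMk (y : (localCohomology J i).obj M) :
    ∃ (n : ℕ) (φ : (powRes J n).complex.X i ⟶ M)
      (h : (powRes J n).complex.d (i + 1) i ≫ φ = 0), lcMk J n φ h = y := by
  have := preservesColimit_forget J i M
  obtain ⟨j, x, hx⟩ := Concrete.isColimit_exists_rep _ (localCohomologyIsColimit J i M) y
  obtain ⟨φ, h, rfl⟩ := exists_extMk (powRes J j.unop.unop) x
  exact ⟨j.unop.unop, φ, h, hx⟩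

theorem lcMk_powLift {m n : ℕ} (hmn : m ≤ n) (φ : (powRes J m).complex.X i ⟶ M)
    (h : (powRes J m).complex.d (i + 1) i ≫ φ = 0) :
    lcMk J n ((powLift J hmn).f i ≫ φ) (powLift_cocycle J hmn h) = lcMk J m φ h := by
  have h1 := ext_map_left_extMk (powRes J m) (powRes J n) (powProj J hmn) (powLift J hmn)
    (powLift_comm J hmn) φ h
  have h2 := colimit.w (localCohomology.diagram (localCohomology.idealPowersDiagram J) i)
    (show op (op m) ⟶ op (op n) from (homOfLE hmn).op.op)
  have h3 := ConcreteCategory.congr_hom (NatTrans.congr_app h2 M) (extMk (powRes J m) φ h)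
  refine Eq.trans ?_ h3
  unfold lcMk
  rw [← h1]
  rfl

theorem lcMk_eq_zero_iff {m : ℕ} (φ : (powRes J m).complex.X i ⟶ M)
    (h : (powRes J m).complex.d (i + 1) i ≫ φ = 0) :
    lcMk J m φ h = 0 ↔ ∃ (n : ℕ) (hmn : m ≤ n),
      extMk (powRes J n) ((powLift J hmn).f i ≫ φ) (powLift_cocycle J hmn h) = 0 := by
  constructor
  · intro h0
    have := preservesColimit_forget J i M
    obtain ⟨k, f, g, hfg⟩ := Concrete.isColimit_exists_of_rep_eq _ (localCohomologyIsColimit J i M)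
      (i := op (op m)) (j := op (op m)) (extMk (powRes J m) φ h) 0
      (h0.trans (map_zero _).symm)
    have hmn : m ≤ k.unop.unop := leOfHom f.unop.unop
    refine ⟨k.unop.unop, hmn, ?_⟩
    rw [← ext_map_left_extMk (powRes J m) (powRes J k.unop.unop) (powProj J hmn) (powLift J hmn)
      (powLift_comm J hmn) φ h]
    exact hfg.trans (map_zero _)
  · rintro ⟨n, hmn, h0⟩
    rw [← lcMk_powLift hmn]
    unfold lcMk
    rw [h0, map_zero]

theorem lcMk_add (n : ℕ) (φ ψ : (powRes J n).complex.X i ⟶ M)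
    (h : (powRes J n).complex.d (i + 1) i ≫ φ = 0)
    (h' : (powRes J n).complex.d (i + 1) i ≫ ψ = 0) :
    lcMk J n (φ + ψ) (by rw [Preadditive.comp_add, h, h', add_zero]) =
      lcMk J n φ h + lcMk J n ψ h' := by
  unfold lcMk
  rw [← map_add, extMk_add]

theorem lcMk_smul (n : ℕ) (r : S) (φ : (powRes J n).complex.X i ⟶ M)
    (h : (powRes J n).complex.d (i + 1) i ≫ φ = 0) :
    lcMk J n (r • φ) (by rw [Linear.comp_smul, h, smul_zero]) = r • lcMk J n φ h := by
  unfold lcMk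
  rw [← map_smul, extMk_smul]

theorem localCohomology_map_lcMk (f : M ⟶ N) (n : ℕ) (φ : (powRes J n).complex.X i ⟶ M)
    (h : (powRes J n).complex.d (i + 1) i ≫ φ = 0) :
    ((localCohomology J i).map f).hom (lcMk J n φ h) =
      lcMk J n (φ ≫ f) (cocycle_comp _ h f) := by
  have h1 := ConcreteCategory.congr_hom ((colimit.ι (localCohomology.diagram
    (localCohomology.idealPowersDiagram J) i) (op (op n))).naturality f)
    (extMk (powRes J n) φ h)
  refine h1.symm.trans ?_
  unfold lcMk
  rw [← ext_map_right_extMk]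
  rfl

theorem lcMk_of_ext_eq_zero {n : ℕ} (φ : (powRes J n).complex.X i ⟶ M)
    (h : (powRes J n).complex.d (i + 1) i ≫ φ = 0) (h0 : extMk (powRes J n) φ h = 0) :
    lcMk J n φ h = 0 := by
  unfold lcMk
  rw [h0, map_zero]

/-- Elements of `J^n` annihilate classes of cocycles on a resolution of `S/J^n`. -/
theorem smul_lcMk_eq_zero {n : ℕ} (φ : (powRes J n).complex.X i ⟶ M)
    (h : (powRes J n).complex.d (i + 1) i ≫ φ = 0) {s : S} (hs : s ∈ J ^ n) :
    s • lcMk J n φ h = 0 := by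
  rw [← lcMk_smul]
  apply lcMk_of_ext_eq_zero
  -- Both `s • 𝟙` and `0` on the resolution lift the zero endomorphism of `S/J^n`, because `s ∈
  -- J^n`; hence they act identically on Ext.
  have h1 := ext_map_left_extMk (powRes J n) (powRes J n) 0
    (s • 𝟙 (powRes J n).complex) (by
      refine Eq.trans ?_ comp_zero.symm
      ext x
      change ((powRes J n).π.f 0).hom (s • x) = 0
      rw [map_smul]
      generalize ((powRes J n).π.f 0).hom x = z
      obtain ⟨t, rfl⟩ := Ideal.Quotient.mk_surjective (show S ⧸ J ^ n from z)
      change Ideal.Quotient.mk (J ^ n) (s * t) = 0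
      exact Ideal.Quotient.eq_zero_iff_mem.2 (Ideal.mul_mem_right _ _ hs)) φ h
  have h2 := ext_map_left_extMk (powRes J n) (powRes J n) 0 0
    (by exact Eq.trans zero_comp comp_zero.symm) φ h
  have h3 : ((s • 𝟙 (powRes J n).complex : (powRes J n).complex ⟶ (powRes J n).complex).f i ≫ φ)
      = s • φ := by
    change (s • 𝟙 _) ≫ φ = _
    rw [Linear.smul_comp, Category.id_comp]
  have h4 : ((0 : (powRes J n).complex ⟶ (powRes J n).complex).f i ≫ φ) = 0 := zero_comp
  simp only [h3] at h1
  simp only [h4] at h2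
  rw [← h1, h2]
  exact extMk_zero _

end LocalCohomologyClasses

/-! ### The long exact sequence, with the connecting map as a relation. -/

section LongExactSequence

variable {S : Type u} [CommRing S] {J : Ideal S} {i : ℕ}

theorem extMk_eq_of_coboundary {X : ModuleCat.{u} S} (P : ProjectiveResolution X) {j : ℕ}
    (hj : (ComplexShape.down ℕ).next i = j) {M : ModuleCat.{u} S} {φ φ' : P.complex.X i ⟶ M}
    (h : P.complex.d (i + 1) i ≫ φ = 0) (h' : P.complex.d (i + 1) i ≫ φ' = 0)
    (ψ : P.complex.X j ⟶ M) (hψ : φ = φ' + P.complex.d i j ≫ ψ) :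
    extMk P φ h = extMk P φ' h' := by
  have hd : P.complex.d (i + 1) i ≫ P.complex.d i j ≫ ψ = 0 := by
    rw [← Category.assoc, P.complex.d_comp_d, zero_comp]
  have h1 := extMk_add P φ' (P.complex.d i j ≫ ψ) h' hd
  have h2 : extMk P (P.complex.d i j ≫ ψ) hd = 0 := (extMk_eq_zero_iff P hj _ hd).2 ⟨ψ, rfl⟩
  subst hψ
  exact h1.trans (by rw [h2, add_zero])

theorem lcMk_eq_of_coboundary {n j : ℕ} (hj : (ComplexShape.down ℕ).next i = j)
    {M : ModuleCat.{u} S} {φ φ' : (powRes J n).complex.X i ⟶ M}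
    (h : (powRes J n).complex.d (i + 1) i ≫ φ = 0)
    (h' : (powRes J n).complex.d (i + 1) i ≫ φ' = 0)
    (ψ : (powRes J n).complex.X j ⟶ M) (hψ : φ = φ' + (powRes J n).complex.d i j ≫ ψ) :
    lcMk J n φ h = lcMk J n φ' h' := by
  unfold lcMk
  rw [extMk_eq_of_coboundary _ hj h h' ψ hψ]

/-- Projectivity lifts `θ` through `X.g`; subtracting the resulting coboundary from `ψ` leaves a map
killed by `X.g`, which factors through `X.f`. -/
theorem exists_lift_of_comp_eq_coboundary {X : ShortComplex (ModuleCat.{u} S)}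
    (hX : X.ShortExact) {Y : ModuleCat.{u} S} (P : ProjectiveResolution Y) {i j : ℕ}
    (ψ : P.complex.X i ⟶ X.X₂) (θ : P.complex.X j ⟶ X.X₃)
    (h : P.complex.d i j ≫ θ = ψ ≫ X.g) :
    ∃ (χ : P.complex.X i ⟶ X.X₁) (θ' : P.complex.X j ⟶ X.X₂),
      ψ = χ ≫ X.f + P.complex.d i j ≫ θ' := by
  have := hX.mono_f
  have := hX.epi_g
  have hk : (ψ - P.complex.d i j ≫ Projective.factorThru θ X.g) ≫ X.g = 0 := by
    rw [Preadditive.sub_comp, Category.assoc, Projective.factorThru_comp, h, sub_self]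
  exact ⟨hX.exact.lift _ hk, Projective.factorThru θ X.g, by
    rw [hX.exact.lift_f _ hk, sub_add_cancel]⟩

theorem localCohomology_exact {X : ShortComplex (ModuleCat.{u} S)} (hX : X.ShortExact)
    (y : (localCohomology J i).obj X.X₂) (hy : ((localCohomology J i).map X.g).hom y = 0) :
    ∃ z, ((localCohomology J i).map X.f).hom z = y := by
  have := hX.mono_f
  obtain ⟨m, φ, h, rfl⟩ := exists_lcMk y
  rw [localCohomology_map_lcMk, lcMk_eq_zero_iff] at hy
  obtain ⟨n, hmn, hy⟩ := hy
  obtain ⟨θ, hθ⟩ := (extMk_eq_zero_iff _ rfl _ _).1 hy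
  rw [← Category.assoc] at hθ
  obtain ⟨χ, θ', e⟩ := exists_lift_of_comp_eq_coboundary hX _ _ _ hθ
  have hχ : (powRes J n).complex.d (i + 1) i ≫ χ = 0 := by
    have h1 := powLift_cocycle J hmn h
    rw [e, Preadditive.comp_add, ← Category.assoc, ← Category.assoc,
      (powRes J n).complex.d_comp_d, zero_comp, add_zero] at h1
    rw [← cancel_mono X.f, h1, zero_comp]
  refine ⟨lcMk J n χ hχ, ?_⟩
  rw [localCohomology_map_lcMk, ← lcMk_powLift hmn φ h]
  exact (lcMk_eq_of_coboundary rfl _ _ θ' e).symm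

/-- `z ∈ H^i_J(X₃)` and `y ∈ H^{i+1}_J(X₁)` correspond under the connecting homomorphism of the
short exact sequence `X`. -/
def ConnectingRel (J : Ideal S) (i : ℕ) (X : ShortComplex (ModuleCat.{u} S))
    (z : (localCohomology J i).obj X.X₃) (y : (localCohomology J (i + 1)).obj X.X₁) : Prop :=
  ∃ (n : ℕ) (ψ : (powRes J n).complex.X i ⟶ X.X₂) (φ : (powRes J n).complex.X (i + 1) ⟶ X.X₁)
    (h : (powRes J n).complex.d (i + 1) i ≫ ψ ≫ X.g = 0)
    (h' : (powRes J n).complex.d (i + 2) (i + 1) ≫ φ = 0),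
    (powRes J n).complex.d (i + 1) i ≫ ψ = φ ≫ X.f ∧
      lcMk J n (ψ ≫ X.g) h = z ∧ lcMk J n φ h' = y

/-- Moves a representing pair to a deeper stage, so that two related pairs can be added at a common
one. -/
theorem ConnectingRel.exists_ge {X : ShortComplex (ModuleCat.{u} S)}
    {z : (localCohomology J i).obj X.X₃} {y : (localCohomology J (i + 1)).obj X.X₁} {m n : ℕ}
    (hmn : m ≤ n) {ψ : (powRes J m).complex.X i ⟶ X.X₂}
    {φ : (powRes J m).complex.X (i + 1) ⟶ X.X₁}
    {h : (powRes J m).complex.d (i + 1) i ≫ ψ ≫ X.g = 0}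
    {h' : (powRes J m).complex.d (i + 2) (i + 1) ≫ φ = 0}
    (H : (powRes J m).complex.d (i + 1) i ≫ ψ = φ ≫ X.f ∧
      lcMk J m (ψ ≫ X.g) h = z ∧ lcMk J m φ h' = y) :
    ∃ (ψ : (powRes J n).complex.X i ⟶ X.X₂) (φ : (powRes J n).complex.X (i + 1) ⟶ X.X₁)
      (h : (powRes J n).complex.d (i + 1) i ≫ ψ ≫ X.g = 0)
      (h' : (powRes J n).complex.d (i + 2) (i + 1) ≫ φ = 0),
      (powRes J n).complex.d (i + 1) i ≫ ψ = φ ≫ X.f ∧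
        lcMk J n (ψ ≫ X.g) h = z ∧ lcMk J n φ h' = y := by
  obtain ⟨H, rfl, rfl⟩ := H
  refine ⟨(powLift J hmn).f i ≫ ψ, (powLift J hmn).f (i + 1) ≫ φ, ?_,
    powLift_cocycle J hmn h', ?_, ?_, lcMk_powLift hmn φ h'⟩
  · simpa using powLift_cocycle J hmn h
  · rw [← Category.assoc, ← (powLift J hmn).comm, Category.assoc, H, Category.assoc]
  · simp only [Category.assoc]
    exact lcMk_powLift hmn _ h

theorem ConnectingRel.add {X : ShortComplex (ModuleCat.{u} S)}
    {z z' : (localCohomology J i).obj X.X₃} {y y' : (localCohomology J (i + 1)).obj X.X₁}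
    (H : ConnectingRel J i X z y) (H' : ConnectingRel J i X z' y') :
    ConnectingRel J i X (z + z') (y + y') := by
  obtain ⟨m, _, _, _, _, H⟩ := H
  obtain ⟨m', _, _, _, _, H'⟩ := H'
  obtain ⟨ψ, φ, h1, h2, h3, rfl, rfl⟩ := ConnectingRel.exists_ge (le_max_left m m') H
  obtain ⟨ψ', φ', h1', h2', h3', rfl, rfl⟩ := ConnectingRel.exists_ge (le_max_right m m') H'
  refine ⟨max m m', ψ + ψ', φ + φ', ?_, ?_, ?_, ?_, lcMk_add _ _ _ _ _⟩
  · rw [Preadditive.add_comp, Preadditive.comp_add, h1, h1', add_zero]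
  · rw [Preadditive.comp_add, h2, h2', add_zero]
  · rw [Preadditive.comp_add, Preadditive.add_comp, h3, h3']
  · simp only [Preadditive.add_comp]
    exact lcMk_add _ _ _ _ _

theorem ConnectingRel.map {X Y : ShortComplex (ModuleCat.{u} S)} (e : X ⟶ Y)
    {z : (localCohomology J i).obj X.X₃} {y : (localCohomology J (i + 1)).obj X.X₁}
    (H : ConnectingRel J i X z y) :
    ConnectingRel J i Y (((localCohomology J i).map e.τ₃).hom z)
      (((localCohomology J (i + 1)).map e.τ₁).hom y) := by
  obtain ⟨n, ψ, φ, h1, h2, h3, rfl, rfl⟩ := H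
  refine ⟨n, ψ ≫ e.τ₂, φ ≫ e.τ₁, ?_, cocycle_comp _ h2 _, ?_, ?_, ?_⟩
  · rw [Category.assoc, e.comm₂₃, ← Category.assoc ψ]
    exact cocycle_comp _ h1 _
  · rw [← Category.assoc, h3, Category.assoc, Category.assoc, e.comm₁₂]
  · rw [localCohomology_map_lcMk]
    simp only [Category.assoc, e.comm₂₃]
  · rw [localCohomology_map_lcMk]

/-- If the cocycle `ψ ≫ X.g` bounds at a later stage, `ψ` can be corrected by a coboundary to take
values in `X.X₁`; the corrected cochain then bounds `φ`. -/
theorem ConnectingRel.eq_zero {X : ShortComplex (ModuleCat.{u} S)} (hX : X.ShortExact)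
    {y : (localCohomology J (i + 1)).obj X.X₁} (H : ConnectingRel J i X 0 y) : y = 0 := by
  have := hX.mono_f
  obtain ⟨m, ψ, φ, h₁, h₂, h₃, hz, rfl⟩ := H
  rw [lcMk_eq_zero_iff] at hz
  obtain ⟨n, hmn, hz⟩ := hz
  obtain ⟨θ, hθ⟩ := (extMk_eq_zero_iff _ rfl _ _).1 hz
  rw [← Category.assoc] at hθ
  obtain ⟨χ, θ', e⟩ := exists_lift_of_comp_eq_coboundary hX _ _ _ hθ
  refine (lcMk_eq_zero_iff _ _).2 ⟨n, hmn, (extMk_succ_eq_zero_iff _ _ _).2 ⟨χ, ?_⟩⟩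
  have h1 : (powRes J n).complex.d (i + 1) i ≫ (powLift J hmn).f i ≫ ψ =
      ((powRes J n).complex.d (i + 1) i ≫ χ) ≫ X.f := by
    rw [e, Preadditive.comp_add, ← Category.assoc, ← Category.assoc _ _ θ',
      (powRes J n).complex.d_comp_d, zero_comp, add_zero]
  rw [← cancel_mono X.f, ← h1, ← Category.assoc, ← (powLift J hmn).comm, Category.assoc, h₃,
    Category.assoc]

theorem exists_connectingRel {X : ShortComplex (ModuleCat.{u} S)}
    (y : (localCohomology J (i + 1)).obj X.X₁)
    (hy : ((localCohomology J (i + 1)).map X.f).hom y = 0) : ∃ z, ConnectingRel J i X z y := by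
  obtain ⟨m, φ₀, h₀, rfl⟩ := exists_lcMk y
  rw [localCohomology_map_lcMk, lcMk_eq_zero_iff] at hy
  obtain ⟨n, hmn, hy⟩ := hy
  obtain ⟨ψ, hψ⟩ := (extMk_succ_eq_zero_iff _ _ _).1 hy
  rw [← Category.assoc] at hψ
  have h : (powRes J n).complex.d (i + 1) i ≫ ψ ≫ X.g = 0 := by
    rw [← Category.assoc, hψ, Category.assoc, X.zero, comp_zero]
  exact ⟨_, n, ψ, _, h, powLift_cocycle J hmn h₀, hψ, rfl, lcMk_powLift hmn φ₀ h₀⟩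

theorem connectingRel_map_zero {X : ShortComplex (ModuleCat.{u} S)}
    (w : (localCohomology J i).obj X.X₂) :
    ConnectingRel J i X (((localCohomology J i).map X.g).hom w) 0 := by
  obtain ⟨n, ω, h, rfl⟩ := exists_lcMk w
  refine ⟨n, ω, 0, cocycle_comp _ h _, comp_zero, by rw [h, zero_comp], ?_,
    lcMk_of_ext_eq_zero _ _ (extMk_zero _)⟩
  rw [localCohomology_map_lcMk]

theorem eq_zero_of_connectingRel_map {X : ShortComplex (ModuleCat.{u} S)} (hX : X.ShortExact)
    (w : (localCohomology J i).obj X.X₂) {y : (localCohomology J (i + 1)).obj X.X₁}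
    (H : ConnectingRel J i X (((localCohomology J i).map X.g).hom w) y) : y = 0 := by
  have h := H.add (connectingRel_map_zero (X := X) (-w))
  rw [map_neg, add_neg_cancel, add_zero] at h
  exact h.eq_zero hX

end LongExactSequence

/-! ### Degree zero: local cohomology and torsion elements. -/

section DegreeZero

variable {S : Type u} [CommRing S] {J : Ideal S} {M N : ModuleCat.{u} S}

theorem quotient_hom_ext {I : Ideal S} {k l : ModuleCat.of S (S ⧸ I) ⟶ M}
    (h : ∀ x : S, k.hom (Submodule.Quotient.mk x) = l.hom (Submodule.Quotient.mk x)) : k = l := by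
  apply ModuleCat.hom_ext
  apply LinearMap.ext
  intro z
  obtain ⟨x, rfl⟩ := Submodule.mkQ_surjective _ z
  exact h x

/-- The augmentation of the resolution of `S/J^n`. -/
noncomputable def powAug (J : Ideal S) (n : ℕ) :
    (powRes J n).complex.X 0 ⟶ ModuleCat.of S (S ⧸ J ^ n) :=
  (powRes J n).π.f 0

theorem d_comp_powAug (J : Ideal S) (n : ℕ) :
    (powRes J n).complex.d (0 + 1) 0 ≫ powAug J n = 0 :=
  ProjectiveResolution.complex_d_comp_π_f_zero _

theorem powAug_exact (J : Ideal S) (n : ℕ) :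
    (ShortComplex.mk _ _ (d_comp_powAug J n)).Exact :=
  (powRes J n).exact₀

instance powAug_epi (J : Ideal S) (n : ℕ) : Epi (powAug J n) :=
  inferInstanceAs (Epi ((powRes J n).π.f 0))

/-- The class in `H^0_J(M)` of a morphism `S/J^n ⟶ M`. -/
noncomputable def lcZeroMk (n : ℕ) (k : ModuleCat.of S (S ⧸ J ^ n) ⟶ M) :
    (localCohomology J 0).obj M :=
  lcMk J n (powAug J n ≫ k) (by rw [← Category.assoc, d_comp_powAug, zero_comp])

/-- The morphism `S/J^n ⟶ M` determined by an element of `M` annihilated by `J^n`. -/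
noncomputable def powHom {n : ℕ} (m : M) (hm : ∀ x ∈ J ^ n, x • m = 0) :
    ModuleCat.of S (S ⧸ J ^ n) ⟶ M :=
  ModuleCat.ofHom (Submodule.liftQ (J ^ n) (LinearMap.toSpanSingleton S M m) hm)

/-- `m` is the element of the `J`-torsion of `M` which corresponds to `y ∈ H^0_J(M)`. -/
def ZeroRel (J : Ideal S) (M : ModuleCat.{u} S) (m : M) (y : (localCohomology J 0).obj M) : Prop :=
  ∃ (n : ℕ) (hm : ∀ x ∈ J ^ n, x • m = 0), lcZeroMk n (powHom m hm) = y

theorem lcZeroMk_powHom {m n : ℕ} (hmn : m ≤ n) (t : M) (ht : ∀ x ∈ J ^ m, x • t = 0) :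
    lcZeroMk n (powHom t fun x hx => ht x (Ideal.pow_le_pow_right hmn hx)) =
      lcZeroMk m (powHom t ht) := by
  unfold lcZeroMk
  rw [← lcMk_powLift hmn]
  congr 1
  have h : (powLift J hmn).f 0 ≫ powAug J m = powAug J n ≫ powProj J hmn := powLift_comm J hmn
  rw [← Category.assoc, h, Category.assoc]
  congr 1
  refine quotient_hom_ext fun x => ?_
  rfl

theorem exists_zeroRel_left (y : (localCohomology J 0).obj M) : ∃ m, ZeroRel J M m y := by
  obtain ⟨n, φ, h, rfl⟩ := exists_lcMk y
  let k : ModuleCat.of S (S ⧸ J ^ n) ⟶ M := (powAug_exact J n).desc φ h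
  have hk : powAug J n ≫ k = φ := (powAug_exact J n).g_desc φ h
  refine ⟨k.hom (Submodule.Quotient.mk 1), n, fun x hx => ?_, ?_⟩
  · rw [← map_smul]
    refine (congrArg k.hom ?_).trans (map_zero k.hom)
    change Submodule.Quotient.mk (x * 1) = 0
    rwa [mul_one, Submodule.Quotient.mk_eq_zero]
  · unfold lcZeroMk
    congr 1
    rw [← hk]
    congr 1
    refine quotient_hom_ext fun x => ?_
    refine (map_smul k.hom x _).symm.trans (congrArg k.hom ?_)
    change Submodule.Quotient.mk (x * 1) = Submodule.Quotient.mk x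
    rw [mul_one]

theorem exists_zeroRel_right (m : M) (hm : ∃ n : ℕ, ∀ x ∈ J ^ n, x • m = 0) :
    ∃ y, ZeroRel J M m y :=
  ⟨_, hm.choose, hm.choose_spec, rfl⟩

theorem ZeroRel.add {m m' : M} {y y' : (localCohomology J 0).obj M} (H : ZeroRel J M m y)
    (H' : ZeroRel J M m' y') : ZeroRel J M (m + m') (y + y') := by
  obtain ⟨n, h, rfl⟩ := H
  obtain ⟨n', h', rfl⟩ := H'
  rw [← lcZeroMk_powHom (le_max_left n n'), ← lcZeroMk_powHom (le_max_right n n')]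
  refine ⟨max n n', fun x hx => ?_, ?_⟩
  · rw [smul_add, h x (Ideal.pow_le_pow_right (le_max_left n n') hx),
      h' x (Ideal.pow_le_pow_right (le_max_right n n') hx), add_zero]
  · unfold lcZeroMk
    rw [← lcMk_add]
    congr 1
    rw [← Preadditive.comp_add]
    congr 1
    refine quotient_hom_ext fun x => ?_
    exact smul_add x m m'

theorem ZeroRel.map {m : M} {y : (localCohomology J 0).obj M} (H : ZeroRel J M m y)
    (f : M ⟶ N) : ZeroRel J N (f.hom m) (((localCohomology J 0).map f).hom y) := by
  obtain ⟨n, h, rfl⟩ := H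
  refine ⟨n, fun x hx => by rw [← map_smul, h x hx, map_zero], ?_⟩
  unfold lcZeroMk
  rw [localCohomology_map_lcMk]
  congr 1
  rw [Category.assoc]
  congr 1
  refine quotient_hom_ext fun x => ?_
  exact (map_smul f.hom x m).symm

theorem ZeroRel.eq_zero {y : (localCohomology J 0).obj M} (H : ZeroRel J M 0 y) : y = 0 := by
  obtain ⟨n, h, rfl⟩ := H
  apply lcMk_of_ext_eq_zero
  have h1 : powHom (0 : M) h = 0 := by
    refine quotient_hom_ext fun x => ?_
    exact smul_zero x
  rw [extMk_zero_eq_zero_iff, h1]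
  exact comp_zero

theorem zeroRel_zero : ZeroRel J M 0 0 := by
  obtain ⟨y, hy⟩ := exists_zeroRel_right (J := J) (0 : M) ⟨0, fun x _ => smul_zero x⟩
  rwa [hy.eq_zero] at hy

theorem ZeroRel.unique {m : M} {y y' : (localCohomology J 0).obj M} (H : ZeroRel J M m y)
    (H' : ZeroRel J M m y') : y = y' := by
  have h := H.add (H'.map (-𝟙 M))
  have e : ((localCohomology J 0).map (-𝟙 M)).hom y' = -y' := by
    rw [Functor.map_neg, CategoryTheory.Functor.map_id]
    rfl
  rw [e] at h
  change ZeroRel J M (m + -m) (y + -y') at h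
  rw [add_neg_cancel] at h
  rw [← sub_eq_zero, sub_eq_add_neg]
  exact h.eq_zero

/-- A class in `H^0_J(N)` is a torsion element of `N`. Any preimage in `M` is automatically torsion,
so it defines a class lifting the given one. -/
theorem localCohomology_zero_map_surjective (f : M ⟶ N) (hf : Function.Surjective f.hom)
    (hM : IsPowTorsion J M) : Function.Surjective ((localCohomology J 0).map f).hom := by
  intro y
  obtain ⟨t, ht⟩ := exists_zeroRel_left y
  obtain ⟨m, rfl⟩ := hf t
  obtain ⟨w, hw⟩ := exists_zeroRel_right m (hM m)
  exact ⟨w, (hw.map f).unique ht⟩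

end DegreeZero

/-! ### The torsion submodule, and torsion in injective modules. -/

section TorsionSubmodule

variable {S : Type u} [CommRing S] (J : Ideal S) (M : Type*) [AddCommGroup M] [Module S M]

/-- The submodule of elements annihilated by a power of `J`. -/
def powTorsion : Submodule S M where
  carrier := {m | ∃ n : ℕ, ∀ x ∈ J ^ n, x • m = 0}
  add_mem' := by
    rintro a b ⟨n, hn⟩ ⟨n', hn'⟩
    refine ⟨max n n', fun x hx => ?_⟩
    rw [smul_add, hn x (Ideal.pow_le_pow_right (le_max_left n n') hx),
      hn' x (Ideal.pow_le_pow_right (le_max_right n n') hx), add_zero]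
  zero_mem' := ⟨0, fun x _ => smul_zero x⟩
  smul_mem' := by
    rintro c a ⟨n, hn⟩
    exact ⟨n, fun x hx => by rw [smul_comm, hn x hx, smul_zero]⟩

theorem isPowTorsion_powTorsion : IsPowTorsion J (powTorsion J M) := by
  rintro ⟨m, n, hn⟩
  exact ⟨n, fun x hx => Subtype.ext (hn x hx)⟩

variable {J M}

theorem IsPowTorsion.of_surjective {N : Type*} [AddCommGroup N] [Module S N] (f : M →ₗ[S] N)
    (hf : Function.Surjective f) (h : IsPowTorsion J M) : IsPowTorsion J N := by
  intro t
  obtain ⟨m, rfl⟩ := hf t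
  obtain ⟨n, hn⟩ := h m
  exact ⟨n, fun x hx => by rw [← map_smul, hn x hx, map_zero]⟩

theorem IsPowTorsion.of_injective {N : Type*} [AddCommGroup N] [Module S N] (f : N →ₗ[S] M)
    (hf : Function.Injective f) (h : IsPowTorsion J M) : IsPowTorsion J N := by
  intro t
  obtain ⟨n, hn⟩ := h (f t)
  exact ⟨n, fun x hx => hf (by rw [map_smul, hn x hx, map_zero])⟩

/-- A finitely generated submodule of `J`-torsion elements is annihilated by a power of `J`. -/
theorem exists_pow_smul_eq_zero_of_fg {N : Submodule S M} (hN : N.FG) (h : N ≤ powTorsion J M) :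
    ∃ n : ℕ, ∀ x ∈ J ^ n, ∀ m ∈ N, x • m = 0 := by
  induction N, hN using Submodule.fg_induction with
  | singleton m =>
    obtain ⟨n, hn⟩ := h (Submodule.mem_span_singleton_self m)
    refine ⟨n, fun x hx t ht => ?_⟩
    obtain ⟨c, rfl⟩ := Submodule.mem_span_singleton.1 ht
    rw [smul_comm, hn x hx, smul_zero]
  | sup N₁ N₂ _ _ h1 h2 =>
    obtain ⟨n, hn⟩ := h1 (le_sup_left.trans h)
    obtain ⟨n', hn'⟩ := h2 (le_sup_right.trans h)
    refine ⟨max n n', fun x hx t ht => ?_⟩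
    obtain ⟨a, ha, b, hb, rfl⟩ := Submodule.mem_sup.1 ht
    rw [smul_add, hn x (Ideal.pow_le_pow_right (le_max_left n n') hx) a ha,
      hn' x (Ideal.pow_le_pow_right (le_max_right n n') hx) b hb, add_zero]

/-- Over a Noetherian ring, the `J`-torsion of an injective module is injective. -/
theorem baer_powTorsion [IsNoetherianRing S] (hM : Module.Baer S M) :
    Module.Baer S (powTorsion J M) := by
  intro I g
  obtain ⟨n, hn⟩ := exists_pow_smul_eq_zero_of_fg (J := J) (N := LinearMap.range g)
    (by rw [LinearMap.range_eq_map]; exact (IsNoetherian.noetherian (⊤ : Submodule S I)).map g)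
    (fun m _ => isPowTorsion_powTorsion J M m)
  -- Artin–Rees gives `J^(k+n) ∩ I ⊆ J^n I`, which `g` kills because `J^n` annihilates its image.
  obtain ⟨k, hk⟩ := J.exists_pow_inf_eq_pow_smul (M := S) I
  have hle : J ^ (k + n) ⊓ I ≤ J ^ n * I := by
    have h := hk (k + n) (Nat.le_add_right k n)
    simp only [smul_eq_mul, Ideal.mul_top, Nat.add_sub_cancel_left] at h
    rw [h]
    exact Ideal.mul_mono_right inf_le_right
  have hg : ∀ x : I, (x : S) ∈ J ^ (k + n) → g x = 0 := by
    intro x hx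
    have h1 : J ^ n * I ≤ Submodule.map I.subtype (LinearMap.ker g) :=
      Ideal.mul_le.2 fun r hr s hs => ⟨r • ⟨s, hs⟩, by
        rw [SetLike.mem_coe, LinearMap.mem_ker, map_smul]
        exact hn r hr _ (LinearMap.mem_range_self g _), rfl⟩
    obtain ⟨y, hy, hyx⟩ := h1 (hle ⟨hx, x.2⟩)
    rw [← show y = x from Subtype.ext hyx]
    exact hy
  -- So `g` factors through the image of `I` in `S/J^(k+n)`. Extending from there, instead of from
  -- `I`, keeps the values of the extension annihilated by `J^(k+n)`, hence torsion.
  let p : I →ₗ[S] S ⧸ J ^ (k + n) := (Submodule.mkQ _).comp I.subtype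
  have hp : LinearMap.ker p ≤ LinearMap.ker g := fun x hx =>
    hg x ((Submodule.Quotient.mk_eq_zero _).1 hx)
  obtain ⟨h, hh⟩ := hM.extension_property ((LinearMap.ker p).liftQ p le_rfl)
    (LinearMap.ker_eq_bot.1 (Submodule.ker_liftQ_eq_bot _ _ _ le_rfl))
    ((powTorsion J M).subtype.comp ((LinearMap.ker p).liftQ g hp))
  refine ⟨(h.comp (Submodule.mkQ (J ^ (k + n)))).codRestrict (powTorsion J M) fun x => ?_, ?_⟩
  · refine ⟨k + n, fun s hs => ?_⟩
    rw [← map_smul]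
    refine (congrArg h ?_).trans (map_zero h)
    exact (Submodule.Quotient.mk_eq_zero _).2 (Ideal.mul_mem_right _ _ hs)
  · intro x hx
    apply Subtype.ext
    exact LinearMap.congr_fun hh (Submodule.Quotient.mk ⟨x, hx⟩)

end TorsionSubmodule

/-! ### Vanishing of higher local cohomology on torsion modules. -/

section Vanishing

variable {S : Type u} [CommRing S] {J : Ideal S}

theorem localCohomology_succ_eq_zero_of_injective {M : ModuleCat.{u} S} [Injective M] {i : ℕ}
    (y : (localCohomology J (i + 1)).obj M) : y = 0 := by
  obtain ⟨n, φ, h, rfl⟩ := exists_lcMk y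
  exact lcMk_of_ext_eq_zero _ _ ((extMk_succ_eq_zero_iff _ _ _).2
    ⟨((powRes J n).exact_succ i).descToInjective φ h,
      ((powRes J n).exact_succ i).comp_descToInjective φ h⟩)

variable [IsNoetherianRing S]

/-- Embed `A` in an injective module. The torsion submodule of the latter contains `A` and is still
injective, which permits dimension shifting within torsion modules. -/
theorem exists_shortExact_powTorsion (A : ModuleCat.{u} S) (hA : IsPowTorsion J A) :
    ∃ X : ShortComplex (ModuleCat.{u} S), X.ShortExact ∧ X.X₁ = A ∧ Injective X.X₂ ∧
      IsPowTorsion J X.X₂ := by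
  let E := Injective.under A
  let ι : A →ₗ[S] E := (Injective.ι A).hom
  have hι : Function.Injective ι := (ModuleCat.mono_iff_injective (Injective.ι A)).1 inferInstance
  have hE : Module.Baer S E := by
    have : Module.Injective S E := 
      (Module.injective_iff_injective_object S E).2
        (show Injective (Injective.under A) from inferInstance)
    exact Module.Baer.of_injective this
  have hmem : ∀ a, ι a ∈ powTorsion J E := fun a => by
    obtain ⟨n, hn⟩ := hA a
    exact ⟨n, fun x hx => by rw [← map_smul, hn x hx, map_zero]⟩
  let f := ι.codRestrict (powTorsion J E) hmem
  have hinj : Module.Injective S (powTorsion J E) := (baer_powTorsion hE).injective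
  refine ⟨ModuleCat.shortComplexOfCompEqZero f (LinearMap.range f).mkQ
    (LinearMap.range_mkQ_comp f), ModuleCat.shortComplex_shortExact _ ?_ ?_ ?_, rfl, ?_,
    isPowTorsion_powTorsion J E⟩
  · exact LinearMap.exact_iff.2 (Submodule.ker_mkQ _)
  · exact fun a b hab => hι (congrArg Subtype.val hab)
  · exact Submodule.mkQ_surjective _
  · exact (Module.injective_iff_injective_object S _).1 hinj

/-- Over a Noetherian ring, the higher local cohomology of a torsion module vanishes. -/
theorem localCohomology_succ_eq_zero_of_isPowTorsion (i : ℕ) :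
    ∀ {A : ModuleCat.{u} S}, IsPowTorsion J A → ∀ y : (localCohomology J (i + 1)).obj A,
      y = 0 := by
  induction i with
  | zero =>
    intro A hA y
    obtain ⟨X, hX, rfl, hI, ht⟩ := exists_shortExact_powTorsion A hA
    -- The class `y` dies in the injective middle term, so it comes from some `z ∈ H^0(X₃)`; but `z`
    -- lifts to `H^0(X₂)`, and therefore `y = 0`.
    obtain ⟨z, hz⟩ := exists_connectingRel y (localCohomology_succ_eq_zero_of_injective _)
    obtain ⟨w, rfl⟩ := localCohomology_zero_map_surjective X.g
      hX.moduleCat_surjective_g ht z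
    exact eq_zero_of_connectingRel_map hX w hz
  | succ i ih =>
    intro A hA y
    obtain ⟨X, hX, rfl, hI, ht⟩ := exists_shortExact_powTorsion A hA
    obtain ⟨z, hz⟩ := exists_connectingRel y (localCohomology_succ_eq_zero_of_injective _)
    rw [ih (IsPowTorsion.of_surjective X.g.hom hX.moduleCat_surjective_g ht) z] at hz
    exact hz.eq_zero hX

end Vanishing

/-! ### Criteria for Artinianness, and prime avoidance. -/

section Artinian

variable {R : Type*} [CommRing R] {M : Type*} [AddCommGroup M] [Module R M]

/-- An `x`-torsion module whose submodule of elements annihilated by `x` is Artinian is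
Artinian. -/
theorem isArtinian_of_isArtinian_ker_smul (x : R) (hx : ∀ m : M, ∃ n : ℕ, x ^ n • m = 0)
    [IsArtinian R (LinearMap.ker (LinearMap.lsmul R M x))] : IsArtinian R M := by
  let K := LinearMap.ker (LinearMap.lsmul R M x)
  -- `D n N` is `x^n N ∩ K`, with `K` the kernel of `x`. It decreases in `n` and increases with `N`,
  -- and the whole sequence determines `N` within a chain.
  let D : ℕ → Submodule R M → Submodule R K := fun n N =>
    (N.map (LinearMap.lsmul R M (x ^ n))).comap K.subtype
  have hD : ∀ n (N : Submodule R M) (k : K), k ∈ D n N ↔ ∃ m ∈ N, x ^ n • m = k :=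
    fun n N k => Iff.rfl
  have hDn : ∀ n N, D (n + 1) N ≤ D n N := by
    rintro n N k ⟨m, hm, e⟩
    refine ⟨x • m, N.smul_mem _ hm, ?_⟩
    change x ^ n • x • m = _
    rw [smul_smul, ← pow_succ]
    exact e
  have hDm : ∀ n N N', N ≤ N' → D n N ≤ D n N' := fun n N N' h k ⟨m, hm, e⟩ => ⟨m, h hm, e⟩
  have hanti : ∀ N, Antitone fun n => D n N := fun N => antitone_nat_of_succ_le fun n => hDn n N
  -- Submodules `N ≤ N'` with the same `D n` for all `n` agree.
  have heq : ∀ N N', N ≤ N' → (∀ n, D n N' ≤ D n N) → N' ≤ N := by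
    intro N N' hle h
    have key : ∀ n, ∀ m ∈ N', x ^ n • m = 0 → m ∈ N := by
      intro n
      induction n with
      | zero =>
        intro m _ h0
        rw [pow_zero, one_smul] at h0
        rw [h0]
        exact N.zero_mem
      | succ n ih =>
        intro m hm h0
        have hk : x ^ n • m ∈ K := by
          change x • x ^ n • m = 0
          rw [smul_smul, ← pow_succ', h0]
        obtain ⟨w, hw, e⟩ := h n (show (⟨x ^ n • m, hk⟩ : K) ∈ D n N' from ⟨m, hm, rfl⟩)
        have e' : x ^ n • w = x ^ n • m := e
        have h1 : m - w ∈ N := ih _ (N'.sub_mem hm (hle hw)) (by rw [smul_sub, e', sub_self])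
        simpa using N.add_mem h1 hw
    intro m hm
    obtain ⟨n, hn⟩ := hx m
    exact key n m hm hn
  rw [← monotone_stabilizes_iff_artinian]
  intro f
  let g : ℕ → Submodule R M := fun k => OrderDual.ofDual (f k)
  have hg : Antitone g := fun a b hab => f.monotone hab
  -- A minimal member of the doubly indexed family makes `D n (g k)` constant for `n ≥ n₀`, `k ≥
  -- k₀`. The finitely many `n < n₀` stabilize separately, and `k₁` dominates all these bounds.
  obtain ⟨_, ⟨⟨n₀, k₀⟩, rfl⟩, hmin⟩ := IsArtinian.set_has_minimal (R := R)
    (Set.range fun p : ℕ × ℕ => D p.1 (g p.2)) (Set.range_nonempty _)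
  have hbig : ∀ n ≥ n₀, ∀ k ≥ k₀, D n (g k) = D n₀ (g k₀) := by
    intro n hn k hk
    have hle : D n (g k) ≤ D n₀ (g k₀) := (hanti _ hn).trans (hDm _ _ _ (hg hk))
    exact hle.eq_of_not_lt (hmin _ ⟨(n, k), rfl⟩)
  have hstab : ∀ n, ∃ k, ∀ k' ≥ k, D n (g k) = D n (g k') := fun n =>
    IsArtinian.monotone_stabilizes (R := R)
      ⟨fun k => OrderDual.toDual (D n (g k)), fun a b hab => hDm n _ _ (hg hab)⟩
  choose κ hκ using hstab
  let k₁ := max k₀ ((Finset.range n₀).sup κ)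
  refine ⟨k₁, fun k hk => ?_⟩
  refine le_antisymm (f.monotone hk) (?_ : g k₁ ≤ g k)
  refine heq _ _ (hg hk) fun n => ?_
  by_cases hn : n < n₀
  · have h1 : κ n ≤ k₁ := (Finset.le_sup (f := κ) (Finset.mem_range.2 hn)).trans (le_max_right _ _)
    rw [← hκ n k₁ h1, ← hκ n k (h1.trans hk)]
  · rw [hbig n (not_lt.1 hn) k₁ (le_max_left _ _),
      hbig n (not_lt.1 hn) k ((le_max_left _ _).trans hk)]

/-- If a submodule `W` of `A × B` meets `0 × B` trivially and projects onto `B`, then `B` is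
Artinian as soon as `A` is. -/
theorem isArtinian_of_relation {A B : Type*} [AddCommGroup A] [Module R A] [AddCommGroup B]
    [Module R B] [IsArtinian R A] (W : Submodule R (A × B)) (h0 : ∀ b, (0, b) ∈ W → b = 0)
    (hs : ∀ b, ∃ a, (a, b) ∈ W) : IsArtinian R B := by
  have h1 : IsArtinian R W := by
    refine isArtinian_of_injective ((LinearMap.fst R A B).comp W.subtype) ?_
    rw [← LinearMap.ker_eq_bot, LinearMap.ker_eq_bot']
    rintro ⟨⟨a, b⟩, hab⟩ (rfl : a = 0)
    exact Subtype.ext (Prod.ext rfl (h0 b hab))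
  exact isArtinian_of_surjective W ((LinearMap.snd R A B).comp W.subtype) fun b =>
    ⟨⟨_, (hs b).choose_spec⟩, rfl⟩

/-- Finite generation puts powers of `a` and `I` in the annihilator `c`. Every prime of `R/c` is
therefore maximal, so `R/c` is an Artinian ring over which `M` is finite. -/
theorem isArtinian_of_fg_of_isPowTorsion [IsNoetherianRing R] {a I : Ideal R}
    (h : ∀ P : Ideal R, P.IsPrime → a ≤ P → I ≤ P → P.IsMaximal) [Module.Finite R M]
    (ha : IsPowTorsion a M) (hI : IsPowTorsion I M) : IsArtinian R M := by
  obtain ⟨k, hk⟩ := exists_pow_smul_eq_zero_of_fg (J := a) (N := (⊤ : Submodule R M))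
    Module.Finite.fg_top fun m _ => ha m
  obtain ⟨l, hl⟩ := exists_pow_smul_eq_zero_of_fg (J := I) (N := (⊤ : Submodule R M))
    Module.Finite.fg_top fun m _ => hI m
  let c := Module.annihilator R M
  have hak : a ^ k ≤ c := fun x hx => Module.mem_annihilator.2 fun m => hk x hx m trivial
  have hIl : I ^ l ≤ c := fun x hx => Module.mem_annihilator.2 fun m => hl x hx m trivial
  have : IsArtinianRing (R ⧸ c) := by
    rw [isArtinianRing_iff_isNoetherianRing_krullDimLE_zero]
    refine ⟨inferInstance, Ring.krullDimLE_zero_iff.2 fun P hP => ?_⟩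
    have hc : c ≤ P.comap (Ideal.Quotient.mk c) := fun x hx => by
      rw [Ideal.mem_comap, Ideal.Quotient.eq_zero_iff_mem.2 hx]
      exact P.zero_mem
    have hmax := h (P.comap (Ideal.Quotient.mk c)) (Ideal.IsPrime.comap _)
      ((Ideal.IsPrime.comap _).le_of_pow_le (hak.trans hc))
      ((Ideal.IsPrime.comap _).le_of_pow_le (hIl.trans hc))
    rw [← Ideal.map_comap_of_surjective _ Ideal.Quotient.mk_surjective P]
    exact (Ideal.map_eq_top_or_isMaximal_of_surjective _ Ideal.Quotient.mk_surjective
      hmax).resolve_left (by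
        rw [Ideal.map_comap_of_surjective _ Ideal.Quotient.mk_surjective P]; exact hP.ne_top)
  let : Module (R ⧸ c) M := Module.quotientAnnihilator
  have : IsScalarTower R (R ⧸ c) M := ⟨fun r s m => by
    obtain ⟨s, rfl⟩ := Ideal.Quotient.mk_surjective s
    exact mul_smul r s m⟩
  have : Module.Finite (R ⧸ c) M := Module.Finite.of_restrictScalars_finite R (R ⧸ c) M
  have h1 : IsArtinian (R ⧸ c) M := inferInstance
  exact (isArtinian_of_surjective_algebraMap (M := M) (R := R ⧸ c) (S := R)
    Ideal.Quotient.mk_surjective)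

/-- A cyclic submodule is `R/c` with `R/c` an Artinian ring. Each maximal ideal over `c` contains a
power of `a`, hence `a`, hence `I`; so `I` maps into the Jacobson radical, which is nilpotent. -/
theorem isPowTorsion_of_isArtinian {a I : Ideal R}
    (h : ∀ P : Ideal R, P.IsMaximal → a ≤ P → I ≤ P) [IsArtinian R M]
    (ha : IsPowTorsion a M) : IsPowTorsion I M := by
  intro t
  obtain ⟨n, hn⟩ := ha t
  let c := Ideal.torsionOf R M t
  have h1 : IsArtinian R (R ⧸ c) :=
    isArtinian_of_linearEquiv (Ideal.quotTorsionOfEquivSpanSingleton R M t).symm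
  have h2 : IsArtinianRing (R ⧸ c) := isArtinian_of_tower R h1
  obtain ⟨k, hk⟩ := IsArtinianRing.isNilpotent_jacobson_bot (R := R ⧸ c)
  refine ⟨k, fun x hx => ?_⟩
  have hI : I.map (Ideal.Quotient.mk c) ≤ Ideal.jacobson ⊥ := by
    rw [Ideal.map_le_iff_le_comap]
    intro y hy
    rw [Ideal.mem_comap, Ideal.jacobson, Ideal.mem_sInf]
    rintro P ⟨-, hP⟩
    refine h (P.comap (Ideal.Quotient.mk c))
      (Ideal.comap_isMaximal_of_surjective _ Ideal.Quotient.mk_surjective) ?_ hy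
    refine (Ideal.IsPrime.comap _).le_of_pow_le (n := n) fun z hz => ?_
    rw [Ideal.mem_comap, Ideal.Quotient.eq_zero_iff_mem.2 (hn z hz)]
    exact P.zero_mem
  have h3 : Ideal.Quotient.mk c x ∈ (Ideal.jacobson ⊥ : Ideal (R ⧸ c)) ^ k :=
    Ideal.pow_right_mono hI k (by rw [← Ideal.map_pow]; exact Ideal.mem_map_of_mem _ hx)
  rw [hk] at h3
  exact Ideal.Quotient.eq_zero_iff_mem.1 h3

/-- Prime avoidance: a finitely generated module without `J`-torsion admits a regular element
in `J`. -/
theorem exists_regular_of_powTorsion_eq_bot [IsNoetherianRing R] {S : Type*} [CommRing S]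
    [Algebra S R] (J : Ideal S) [Module.Finite R M]
    (h : powTorsion (J.map (algebraMap S R)) M = ⊥) :
    ∃ x ∈ J, ∀ m : M, algebraMap S R x • m = 0 → m = 0 := by
  by_contra! hcon
  -- Avoidance is applied in `S` to the contractions of the associated primes, so that the regular
  -- element lies in `J` itself and not just in `JR`.
  have hsub : (J : Set S) ⊆ ⋃ P ∈ associatedPrimes R M, (P.comap (algebraMap S R) : Ideal S) := by
    intro x hx
    obtain ⟨m, hm, hm0⟩ := hcon x hx
    have h1 : algebraMap S R x ∈ ⋃ P ∈ associatedPrimes R M, (P : Set R) := by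
      rw [biUnion_associatedPrimes_eq_zero_divisors]
      exact ⟨m, hm0, hm⟩
    simpa using h1
  -- The two `⊥` fill the slots for members allowed not to be prime; here all of them are prime.
  obtain ⟨P, hP, hJP⟩ := (Ideal.subset_union_prime_finite (associatedPrimes.finite R M)
    (f := fun P => P.comap (algebraMap S R)) ⊥ ⊥
    fun P hP _ _ => have := hP.isPrime; Ideal.IsPrime.comap _).1 hsub
  obtain ⟨hP, m, rfl⟩ := isAssociatedPrime_iff.1 hP
  have hm : m ∈ powTorsion (J.map (algebraMap S R)) M := by
    refine ⟨1, fun x hx => ?_⟩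
    rw [pow_one] at hx
    exact (Submodule.mem_bot R).1
      (Submodule.mem_colon_singleton.1 (Ideal.map_le_iff_le_comap.2 hJP hx))
  rw [h, Submodule.mem_bot] at hm
  refine hP.ne_top ((Ideal.eq_top_iff_one _).2 (Submodule.mem_colon_singleton.2 ?_))
  rw [hm, smul_zero]
  exact Submodule.zero_mem _

/-- If `I^n m` is torsion, it generates a finitely generated torsion submodule, killed by some
`I^k`; then `I^(k+n)` kills `m`. -/
theorem powTorsion_quotient_powTorsion [IsNoetherian R M] (I : Ideal R) :
    powTorsion I (M ⧸ powTorsion I M) = ⊥ := by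
  rw [eq_bot_iff]
  rintro t ⟨n, hn⟩
  obtain ⟨m, rfl⟩ := Submodule.mkQ_surjective _ t
  have hN : I ^ n • Submodule.span R {m} ≤ powTorsion I M := by
    refine Submodule.smul_le.2 fun r hr s hs => ?_
    obtain ⟨c, rfl⟩ := Submodule.mem_span_singleton.1 hs
    rw [smul_comm]
    refine Submodule.smul_mem _ c ((Submodule.Quotient.mk_eq_zero _).1 ?_)
    exact hn r hr
  obtain ⟨k, hk⟩ := exists_pow_smul_eq_zero_of_fg (IsNoetherian.noetherian _) hN
  rw [Submodule.mem_bot]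
  refine (Submodule.Quotient.mk_eq_zero _).2 ⟨k + n, ?_⟩
  have h1 : I ^ (k + n) ≤ Ideal.torsionOf R M m := by
    rw [pow_add]
    refine Ideal.mul_le.2 fun r hr s hs => ?_
    rw [Ideal.mem_torsionOf_iff, mul_smul]
    exact hk r hr _ (Submodule.smul_mem_smul hs (Submodule.mem_span_singleton_self m))
  exact fun x hx => h1 hx

end Artinian

/-! ### Artinianness of local cohomology with its induced action. -/

section LocalCohomologyOver

variable {S R : Type u} [CommRing S] [CommRing R] [Algebra S R] {J : Ideal S} {i : ℕ}

theorem restrict_map_comp_mulHom {T U : ModuleCat.{u} R} (f : T ⟶ U) (r : R) :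
    (ModuleCat.restrictScalars (algebraMap S R)).map f ≫ mulHom S U r =
      mulHom S T r ≫ (ModuleCat.restrictScalars (algebraMap S R)).map f := by
  unfold mulHom
  rw [← Functor.map_comp, ← Functor.map_comp]
  congr 1
  ext t
  exact (map_smul f.hom r t).symm

/-- The `R`-linear map on modules induced by an additive functor. -/
noncomputable def inducedModuleMap (F : ModuleCat.{u} S ⥤ ModuleCat.{u} S) [F.Additive]
    {T U : ModuleCat.{u} R} (f : T ⟶ U) : inducedModule F T →ₗ[R] inducedModule F U where
  toFun := (F.map ((ModuleCat.restrictScalars (algebraMap S R)).map f)).hom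
  map_add' := map_add _
  map_smul' r y := by
    have h := congrArg F.map (restrict_map_comp_mulHom (S := S) f r)
    rw [F.map_comp, F.map_comp] at h
    exact (ConcreteCategory.congr_hom h y).symm

variable (J i) in
/-- The `R`-linear map on local cohomology induced by a morphism of `R`-modules. -/
noncomputable def lcMap {T U : ModuleCat.{u} R} (f : T ⟶ U) :
    localCohomologyOver J i T →ₗ[R] localCohomologyOver J i U :=
  inducedModuleMap (localCohomology J i) f

/-- A short complex of `R`-modules regarded as a short complex of `S`-modules. -/
noncomputable abbrev restrictComplex (S : Type u) [CommRing S] [Algebra S R]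
    (Y : ShortComplex (ModuleCat.{u} R)) : ShortComplex (ModuleCat.{u} S) :=
  Y.map (ModuleCat.restrictScalars (algebraMap S R))

theorem restrictComplex_shortExact {Y : ShortComplex (ModuleCat.{u} R)} (hY : Y.ShortExact) :
    (restrictComplex S Y).ShortExact :=
  ModuleCat.shortComplex_shortExact _
    (fun x => (ShortComplex.ShortExact.moduleCat_exact_iff_function_exact Y).1 hY.exact x)
    hY.moduleCat_injective_f hY.moduleCat_surjective_g

theorem isArtinian_lc_middle {Y : ShortComplex (ModuleCat.{u} R)} (hY : Y.ShortExact)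
    (h₁ : IsArtinian R (localCohomologyOver J i Y.X₁))
    (h₃ : IsArtinian R (localCohomologyOver J i Y.X₃)) :
    IsArtinian R (localCohomologyOver J i Y.X₂) := by
  refine isArtinian_of_range_eq_ker (lcMap J i Y.f) (lcMap J i Y.g) (le_antisymm ?_ ?_)
  · rintro _ ⟨z, rfl⟩
    have h := congrArg (localCohomology J i).map (restrictComplex S Y).zero
    rw [Functor.map_comp, Functor.map_zero] at h
    exact ConcreteCategory.congr_hom h z
  · intro y hy
    obtain ⟨z, hz⟩ := localCohomology_exact (J := J) (restrictComplex_shortExact hY) y hy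
    exact ⟨z, hz⟩

/-- Multiplication by `r` on a short complex of `R`-modules. -/
noncomputable def mulComplex (S : Type u) [CommRing S] [Algebra S R]
    (Y : ShortComplex (ModuleCat.{u} R)) (r : R) : restrictComplex S Y ⟶ restrictComplex S Y where
  τ₁ := mulHom S Y.X₁ r
  τ₂ := mulHom S Y.X₂ r
  τ₃ := mulHom S Y.X₃ r
  comm₁₂ := (restrict_map_comp_mulHom Y.f r).symm
  comm₂₃ := (restrict_map_comp_mulHom Y.g r).symm

/-- This kernel is the image of the connecting homomorphism from `H^i(X₃)`. The relation `W` is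
`R`-stable because multiplication by `r` is an endomorphism of the whole short exact sequence. -/
theorem isArtinian_ker_lcMap {Y : ShortComplex (ModuleCat.{u} R)} (hY : Y.ShortExact)
    (h₃ : IsArtinian R (localCohomologyOver J i Y.X₃)) :
    IsArtinian R (LinearMap.ker (lcMap J (i + 1) Y.f)) := by
  let W : Submodule R (localCohomologyOver J i Y.X₃ × LinearMap.ker (lcMap J (i + 1) Y.f)) :=
    { carrier := {p | ConnectingRel J i (restrictComplex S Y) p.1 p.2.1}
      add_mem' := fun h h' => h.add h'
      zero_mem' := by
        have h := connectingRel_map_zero (J := J) (i := i) (X := restrictComplex S Y) 0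
        rw [map_zero] at h
        exact h
      smul_mem' := fun r _ h => h.map (mulComplex S Y r) }
  refine isArtinian_of_relation W ?_ ?_
  · rintro ⟨y, hy⟩ h
    exact Subtype.ext (ConnectingRel.eq_zero (restrictComplex_shortExact hY) h)
  · rintro ⟨y, hy⟩
    exact exists_connectingRel (X := restrictComplex S Y) y hy

theorem forall_mem_map_pow_smul_eq_zero_iff {T : Type*} [AddCommGroup T] [Module R T] {n : ℕ}
    {m : T} : (∀ x ∈ J.map (algebraMap S R) ^ n, x • m = 0) ↔
      ∀ x ∈ J ^ n, algebraMap S R x • m = 0 := by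
  rw [← Ideal.map_pow]
  constructor
  · exact fun h x hx => h _ (Ideal.mem_map_of_mem _ hx)
  · intro h
    have h1 : (J ^ n).map (algebraMap S R) ≤ Ideal.torsionOf R T m :=
      Ideal.map_le_iff_le_comap.2 fun x hx => h x hx
    exact fun x hx => h1 hx

theorem isArtinian_lc_zero {T : ModuleCat.{u} R}
    (h : IsArtinian R (powTorsion (J.map (algebraMap S R)) T)) :
    IsArtinian R (localCohomologyOver J 0 T) := by
  let W : Submodule R (powTorsion (J.map (algebraMap S R)) T × localCohomologyOver J 0 T) :=
    { carrier := {p | ZeroRel J (restrict S T) p.1.1 p.2}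
      add_mem' := fun {p q} h h' =>
        ZeroRel.add (M := restrict S T) (m := p.1.1) (m' := q.1.1) h h'
      zero_mem' := zeroRel_zero (M := restrict S T)
      smul_mem' := fun r p h => ZeroRel.map (M := restrict S T) (m := p.1.1) h (mulHom S T r) }
  refine isArtinian_of_relation W (fun y hy => ZeroRel.eq_zero (M := restrict S T) hy) fun y => ?_
  obtain ⟨m, hm⟩ := exists_zeroRel_left (J := J) (M := restrict S T) y
  exact ⟨⟨m, hm.choose, forall_mem_map_pow_smul_eq_zero_iff.2 hm.choose_spec.choose⟩, hm⟩

theorem isPowTorsion_restrict {T : ModuleCat.{u} R}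
    (h : IsPowTorsion (J.map (algebraMap S R)) T) : IsPowTorsion J (restrict S T) := fun t =>
  let ⟨n, hn⟩ := h t
  ⟨n, (forall_mem_map_pow_smul_eq_zero_iff (S := S) (R := R) (T := T)).1 hn⟩

theorem isArtinian_lc_succ_of_isPowTorsion [IsNoetherianRing S] {T : ModuleCat.{u} R}
    (h : IsPowTorsion (J.map (algebraMap S R)) T) :
    IsArtinian R (localCohomologyOver J (i + 1) T) := by
  have : Subsingleton (localCohomologyOver J (i + 1) T) := subsingleton_of_forall_eq 0 fun y =>
    localCohomology_succ_eq_zero_of_isPowTorsion i (isPowTorsion_restrict h) y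
  infer_instance

theorem exists_pow_smul_lc_eq_zero {T : ModuleCat.{u} R} {x : S} (hx : x ∈ J)
    (y : localCohomologyOver J i T) : ∃ n : ℕ, algebraMap S R x ^ n • y = 0 := by
  obtain ⟨n, φ, h, rfl⟩ := exists_lcMk (J := J) (M := restrict S T) y
  refine ⟨n, ?_⟩
  change ((localCohomology J i).map (mulHom S T _)).hom _ = 0
  rw [localCohomology_map_lcMk]
  refine Eq.trans ?_ (smul_lcMk_eq_zero φ h (Ideal.pow_mem_pow hx n))
  rw [← lcMk_smul]
  congr 1
  rw [← map_pow]
  rfl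

/-- Local cohomology of finitely generated `a`-torsion modules is Artinian when `a + JR` is
contained only in maximal primes. -/
theorem isArtinian_lc_of_finite [IsNoetherianRing S] [IsNoetherianRing R] {a : Ideal R}
    (h : ∀ P : Ideal R, P.IsPrime → a ≤ P → J.map (algebraMap S R) ≤ P → P.IsMaximal) (i : ℕ) :
    ∀ (L : Type u) [AddCommGroup L] [Module R L] [Module.Finite R L], IsPowTorsion a L →
      IsArtinian R (localCohomologyOver J i (ModuleCat.of R L)) := by
  induction i with
  | zero =>
    intro L _ _ _ ha
    exact isArtinian_lc_zero (isArtinian_of_fg_of_isPowTorsion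
      (M := powTorsion (J.map (algebraMap S R)) L) h
      (ha.of_injective _ (Submodule.injective_subtype _)) (isPowTorsion_powTorsion _ _))
  | succ i ih =>
    intro L _ _ _ ha
    let N := powTorsion (J.map (algebraMap S R)) L
    have hLN : IsPowTorsion a (L ⧸ N) := ha.of_surjective _ N.mkQ_surjective
    -- Modulo its torsion the module admits a regular `x ∈ J`. The cokernel of `x` feeds the
    -- induction hypothesis and controls the kernel of `x` one degree higher.
    obtain ⟨x, hx, hreg⟩ := exists_regular_of_powTorsion_eq_bot (M := L ⧸ N) J
      (powTorsion_quotient_powTorsion _)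
    let f : (L ⧸ N) →ₗ[R] L ⧸ N := LinearMap.lsmul R (L ⧸ N) (algebraMap S R x)
    have hf : Function.Injective f := (injective_iff_map_eq_zero f).2 hreg
    have h₃ := ih ((L ⧸ N) ⧸ LinearMap.range f)
      (hLN.of_surjective _ (LinearMap.range f).mkQ_surjective)
    have hker : IsArtinian R (LinearMap.ker (lcMap J (i + 1) (ModuleCat.ofHom f))) :=
      isArtinian_ker_lcMap (Y := ModuleCat.shortComplexOfCompEqZero f (LinearMap.range f).mkQ
        (LinearMap.range_mkQ_comp f)) (ModuleCat.shortComplex_shortExact _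
          (LinearMap.exact_iff.2 (Submodule.ker_mkQ _)) hf (Submodule.mkQ_surjective _)) h₃
    have hq : IsArtinian R (localCohomologyOver J (i + 1) (ModuleCat.of R (L ⧸ N))) := by
      have : IsArtinian R (LinearMap.ker (LinearMap.lsmul R
        (localCohomologyOver J (i + 1) (ModuleCat.of R (L ⧸ N))) (algebraMap S R x))) := hker
      exact isArtinian_of_isArtinian_ker_smul (algebraMap S R x) (exists_pow_smul_lc_eq_zero hx)
    exact isArtinian_lc_middle (Y := ModuleCat.shortComplexOfCompEqZero N.subtype N.mkQ
      (by ext; simp)) (ModuleCat.shortComplex_shortExact _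
        (LinearMap.exact_subtype_mkQ N) N.injective_subtype N.mkQ_surjective)
      (isArtinian_lc_succ_of_isPowTorsion (T := ModuleCat.of R N) (isPowTorsion_powTorsion _ _)) hq

/-- Hypothesis `h` serves the finitely generated part `L`; `h'` makes the Artinian part `T/L`
torsion for `JR`, leaving it only degree-zero cohomology. -/
theorem isArtinian_localCohomologyOver_of_isMinimax [IsNoetherianRing S] [IsNoetherianRing R]
    {a : Ideal R}
    (h : ∀ P : Ideal R, P.IsPrime → a ≤ P → J.map (algebraMap S R) ≤ P → P.IsMaximal)
    (h' : ∀ P : Ideal R, P.IsMaximal → a ≤ P → J.map (algebraMap S R) ≤ P)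
    {T : Type u} [AddCommGroup T] [Module R T] (ha : IsPowTorsion a T) (hT : IsMinimax R T)
    (i : ℕ) : IsArtinian R (localCohomologyOver J i (ModuleCat.of R T)) := by
  obtain ⟨L, hL, hTL⟩ := hT
  have : Module.Finite R L := Module.Finite.iff_fg.2 hL
  refine isArtinian_lc_middle (Y := ModuleCat.shortComplexOfCompEqZero L.subtype L.mkQ
    (by ext; simp)) (ModuleCat.shortComplex_shortExact _
      (LinearMap.exact_subtype_mkQ L) L.injective_subtype L.mkQ_surjective)
    (isArtinian_lc_of_finite h i L (ha.of_injective _ L.injective_subtype)) ?_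
  have hq : IsPowTorsion (J.map (algebraMap S R)) (T ⧸ L) :=
    isPowTorsion_of_isArtinian h' (ha.of_surjective _ L.mkQ_surjective)
  cases i with
  | zero =>
    exact isArtinian_lc_zero (T := ModuleCat.of R (T ⧸ L)) (isArtinian_of_injective
      (powTorsion (J.map (algebraMap S R)) (T ⧸ L)).subtype (Submodule.injective_subtype _))
  | succ i => exact isArtinian_lc_succ_of_isPowTorsion (T := ModuleCat.of R (T ⧸ L)) hq

/-- Local cohomology over `R` itself, with its own module structure. -/
theorem isArtinian_localCohomology_of_localCohomologyOver {I : Ideal R} {T : Type u}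
    [AddCommGroup T] [Module R T]
    (h : IsArtinian R (localCohomologyOver I i (ModuleCat.of R T))) :
    IsArtinian R ((localCohomology I i).obj (ModuleCat.of R T)) := by
  let e : restrict R (ModuleCat.of R T) ≅ ModuleCat.of R T :=
    (ModuleCat.restrictScalarsId' (algebraMap R R) rfl).app (ModuleCat.of R T)
  let g : localCohomologyOver I i (ModuleCat.of R T) →ₗ[R]
      (localCohomology I i).obj (ModuleCat.of R T) :=
    { toFun := ((localCohomology I i).map e.hom).hom
      map_add' := map_add _
      map_smul' := fun r y => by
        -- The action induced by functoriality and the one native to Ext agree on cocycles, where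
        -- both multiply the values by `r`.
        obtain ⟨n, φ, h, rfl⟩ := exists_lcMk (J := I) (M := restrict R (ModuleCat.of R T)) y
        change ((localCohomology I i).map e.hom).hom (((localCohomology I i).map
          (mulHom R (ModuleCat.of R T) r)).hom (lcMk I n φ h)) =
          r • ((localCohomology I i).map e.hom).hom (lcMk I n φ h)
        rw [localCohomology_map_lcMk, ← map_smul, ← lcMk_smul]
        rfl }
  refine isArtinian_of_surjective _ g fun z => ?_
  exact ⟨((localCohomology I i).map e.inv).hom z,
    iso_hom_inv_apply ((localCohomology I i).mapIso e) z⟩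

end LocalCohomologyOver

/-! ### Resolutions by finitely generated projectives. -/

section FiniteResolution

variable (S : Type u) [CommRing S] [IsNoetherianRing S]

theorem projective_fgModuleCat_of_free (n : ℕ) :
    Projective (FGModuleCat.of S (Fin n → S)) where
  factors {E X} f e _ := by
    have he : Epi ((forget₂ (FGModuleCat.{u} S) (ModuleCat.{u} S)).map e) := inferInstance
    have hs : Function.Surjective e.hom.hom := (ModuleCat.epi_iff_surjective _).1 he
    obtain ⟨g, hg⟩ := Module.projective_lifting_property e.hom.hom f.hom.hom hs
    exact ⟨ObjectProperty.homMk (ModuleCat.ofHom g), by ext x; exact LinearMap.congr_fun hg _⟩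

theorem exists_free_epi (X : FGModuleCat.{u} S) :
    ∃ (n : ℕ) (f : FGModuleCat.of S (Fin n → S) ⟶ X), Epi f := by
  obtain ⟨n, f, hf⟩ := Module.Finite.exists_fin' S X
  refine ⟨n, ObjectProperty.homMk (ModuleCat.ofHom f), ?_⟩
  apply (forget₂ (FGModuleCat.{u} S) (ModuleCat.{u} S)).epi_of_epi_map
  exact (ModuleCat.epi_iff_surjective _).2 hf

instance enoughProjectives_fgModuleCat : EnoughProjectives (FGModuleCat.{u} S) where
  presentation X := by
    obtain ⟨n, f, hf⟩ := exists_free_epi S X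
    exact ⟨{ p := FGModuleCat.of S (Fin n → S)
             projective := projective_fgModuleCat_of_free S n
             f := f
             epi := hf }⟩

/-- A projective object of the finitely generated category is a retract of a free module of finite
rank, hence projective among all modules. -/
instance forget₂_fgModuleCat_preservesProjective :
    (forget₂ (FGModuleCat.{u} S) (ModuleCat.{u} S)).PreservesProjectiveObjects where
  projective_obj {X} _ := by
    obtain ⟨n, f, hf⟩ := exists_free_epi S X
    let F := forget₂ (FGModuleCat.{u} S) (ModuleCat.{u} S)
    have h : Projective (ModuleCat.of S (Fin n → S)) :=
      (IsProjective.iff_projective _).1 inferInstance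
    have hr : Retract (F.obj X) (ModuleCat.of S (Fin n → S)) :=
      { i := F.map (Projective.factorThru (𝟙 X) f)
        r := F.map f
        retract := by
          rw [← F.map_comp, Projective.factorThru_comp]
          exact F.map_id X }
    exact hr.projective

/-- Over a Noetherian ring, a finitely generated module has a resolution by finitely generated
projective modules. -/
theorem exists_finite_projectiveResolution (X : ModuleCat.{u} S) [Module.Finite S X] :
    ∃ P : ProjectiveResolution X, ∀ i, Module.Finite S (P.complex.X i) := by
  let F := forget₂ (FGModuleCat.{u} S) (ModuleCat.{u} S)
  let Q : ProjectiveResolution (FGModuleCat.of S X) := projectiveResolution _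
  let π : (F.mapHomologicalComplex _).obj Q.complex ⟶ (ChainComplex.single₀ _).obj X :=
    (F.mapHomologicalComplex _).map Q.π ≫
      (HomologicalComplex.singleMapHomologicalComplex F (ComplexShape.down ℕ) 0).hom.app _
  refine ⟨{ complex := (F.mapHomologicalComplex _).obj Q.complex
            projective := fun i => inferInstanceAs (Projective (F.obj (Q.complex.X i)))
            π := π
            quasiIso := ?_ }, fun i => (Q.complex.X i).property⟩
  exact inferInstanceAs (QuasiIso ((F.mapHomologicalComplex _).map Q.π ≫
    (HomologicalComplex.singleMapHomologicalComplex F (ComplexShape.down ℕ) 0).hom.app _))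

end FiniteResolution

/-! ### Closure properties of minimax modules. -/

section Minimax

variable {R : Type*} [CommRing R] {T : Type*} [AddCommGroup T] [Module R T]

theorem IsMinimax.of_ker_fg {A : Type*} [AddCommGroup A] [Module R A] [IsArtinian R A]
    (g : T →ₗ[R] A) (h : (LinearMap.ker g).FG) : IsMinimax R T :=
  ⟨LinearMap.ker g, h, isArtinian_of_injective ((LinearMap.ker g).liftQ g le_rfl)
    (LinearMap.ker_eq_bot.1 (Submodule.ker_liftQ_eq_bot _ _ _ le_rfl))⟩

theorem IsMinimax.of_injective [IsNoetherianRing R] {U : Type*} [AddCommGroup U] [Module R U]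
    (f : U →ₗ[R] T) (hf : Function.Injective f) (hT : IsMinimax R T) : IsMinimax R U := by
  obtain ⟨L, hL, hA⟩ := hT
  refine IsMinimax.of_ker_fg (L.mkQ.comp f) ?_
  have : Module.Finite R L := Module.Finite.iff_fg.2 hL
  let g : LinearMap.ker (L.mkQ.comp f) →ₗ[R] L :=
    (f.comp (Submodule.subtype _)).codRestrict L fun x =>
      (Submodule.Quotient.mk_eq_zero _).1 x.2
  rw [← Module.Finite.iff_fg]
  exact Module.Finite.of_injective g fun x y h => Subtype.ext (hf (congrArg Subtype.val h))

theorem IsMinimax.of_surjective {U : Type*} [AddCommGroup U] [Module R U]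
    (f : T →ₗ[R] U) (hf : Function.Surjective f) (hT : IsMinimax R T) : IsMinimax R U := by
  obtain ⟨L, hL, hA⟩ := hT
  exact ⟨L.map f, hL.map f, isArtinian_of_surjective (T ⧸ L)
    (L.mapQ (L.map f) f (Submodule.le_comap_map f L)) fun z => by
      obtain ⟨u, rfl⟩ := Submodule.mkQ_surjective _ z
      obtain ⟨t, rfl⟩ := hf u
      exact ⟨Submodule.Quotient.mk t, rfl⟩⟩

theorem IsMinimax.pi [IsNoetherianRing R] (ι : Type*) [Finite ι] (hT : IsMinimax R T) :
    IsMinimax R (ι → T) := by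
  obtain ⟨L, hL, hA⟩ := hT
  have : Module.Finite R L := Module.Finite.iff_fg.2 hL
  refine IsMinimax.of_ker_fg (LinearMap.compLeft L.mkQ ι) ?_
  let g : LinearMap.ker (LinearMap.compLeft L.mkQ ι) →ₗ[R] ι → L :=
    LinearMap.pi fun j => ((LinearMap.proj j).comp (Submodule.subtype _)).codRestrict L fun x =>
      (Submodule.Quotient.mk_eq_zero L (x := x.1 j)).1 (congrFun x.2 j)
  rw [← Module.Finite.iff_fg]
  exact Module.Finite.of_injective g fun x y h =>
    Subtype.ext (funext fun j => congrArg Subtype.val (congrFun h j))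

theorem IsPowTorsion.pi {a : Ideal R} (ι : Type*) [Finite ι] (h : IsPowTorsion a T) :
    IsPowTorsion a (ι → T) := by
  have := Fintype.ofFinite ι
  intro t
  choose n hn using fun j => h (t j)
  exact ⟨Finset.univ.sup n, fun x hx => funext fun j =>
    hn j x (Ideal.pow_le_pow_right (Finset.le_sup (Finset.mem_univ j)) hx)⟩

/-- The finitely generated submodule inherits both torsion conditions and is Artinian by the finite
case; the quotient is Artinian by definition. -/
theorem IsMinimax.isArtinian [IsNoetherianRing R] {a I : Ideal R}
    (h : ∀ P : Ideal R, P.IsPrime → a ≤ P → I ≤ P → P.IsMaximal) (hT : IsMinimax R T)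
    (ha : IsPowTorsion a T) (hI : IsPowTorsion I T) : IsArtinian R T := by
  obtain ⟨L, hL, hA⟩ := hT
  have : Module.Finite R L := Module.Finite.iff_fg.2 hL
  exact (isArtinian_iff_submodule_quotient L).2 ⟨isArtinian_of_fg_of_isPowTorsion h
    (ha.of_injective _ L.injective_subtype) (hI.of_injective _ L.injective_subtype), hA⟩

end Minimax

/-! ### Tor as a subquotient of a finite power of the module. -/

section Tor

variable {S R : Type u} [CommRing S] [CommRing R] [Algebra S R]

open MonoidalCategory

/-- `P ⊗_S T` with its `R`-module structure. -/
noncomputable abbrev tensorOver (P : ModuleCat.{u} S) (T : ModuleCat.{u} R) : ModuleCat.{u} R :=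
  inducedModule (tensorLeft P) T

/-- Generators `p j` of `P` give `(t_j) ↦ ∑ p j ⊗ t_j`; coefficients from `S` are moved across the
tensor sign onto `T`. -/
theorem exists_surjective_tensorOver (P : ModuleCat.{u} S) [Module.Finite S P]
    (T : ModuleCat.{u} R) :
    ∃ (n : ℕ) (f : (Fin n → T) →ₗ[R] tensorOver P T), Function.Surjective f := by
  obtain ⟨n, p, hp⟩ := Module.Finite.exists_fin (R := S) (M := P)
  let τ : P → T → tensorOver P T := fun x t =>
    TensorProduct.tmul S (x : P) (t : restrict S T)
  let ι : P → T →ₗ[R] tensorOver P T := fun x =>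
    { toFun := τ x
      map_add' := fun t t' => TensorProduct.tmul_add (M := P) (N := restrict S T) x t t'
      map_smul' := fun r t => rfl }
  refine ⟨n, ∑ j, (ι (p j)).comp (LinearMap.proj j), ?_⟩
  rw [← LinearMap.range_eq_top]
  set N := LinearMap.range (∑ j, (ι (p j)).comp (LinearMap.proj (R := R) (φ := fun _ => T) j))
  have h1 : ∀ j t, τ (p j) t ∈ N := fun j t => ⟨Pi.single j t, by
    rw [LinearMap.sum_apply, Finset.sum_eq_single j]
    · change τ (p j) ((Pi.single j t : Fin n → T) j) = _
      rw [Pi.single_eq_same]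
    · intro k _ hk
      change ι (p k) ((Pi.single j t : Fin n → T) k) = 0
      rw [Pi.single_eq_of_ne hk, map_zero]
    · simp⟩
  have h2 : ∀ x t, τ x t ∈ N := by
    intro x
    have hx : x ∈ Submodule.span S (Set.range p) := hp ▸ Submodule.mem_top
    induction hx using Submodule.span_induction with
    | mem x hx => obtain ⟨j, rfl⟩ := hx; exact h1 j
    | zero =>
      intro t
      rw [show τ 0 t = 0 from TensorProduct.zero_tmul _ _]
      exact N.zero_mem
    | add x y _ _ hx hy =>
      intro t
      rw [show τ (x + y) t = τ x t + τ y t from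
        TensorProduct.add_tmul _ _ _]
      exact N.add_mem (hx t) (hy t)
    | smul s x _ hx =>
      intro t
      rw [show τ (s • x) t = τ x (algebraMap S R s • t) from
        TensorProduct.smul_tmul (M := P) (N := restrict S T) s x t]
      exact hx _
  rw [eq_top_iff]
  intro z _
  induction z using TensorProduct.induction_on with
  | zero => exact N.zero_mem
  | tmul x t => exact h2 x t
  | add y z hy hz => exact N.add_mem (hy trivial) (hz trivial)

variable {X : ModuleCat.{u} S} (P : ProjectiveResolution X) (T : ModuleCat.{u} R)

/-- The complex `P ⊗_S T`. -/
noncomputable abbrev tensorComplex : ChainComplex (ModuleCat.{u} S) ℕ :=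
  (((tensoringRight (ModuleCat.{u} S)).obj (restrict S T)).mapHomologicalComplex _).obj P.complex

/-- Multiplication by `r` on the complex `P ⊗_S T`. -/
noncomputable def mulTensor (r : R) : tensorComplex P T ⟶ tensorComplex P T :=
  (NatTrans.mapHomologicalComplex ((tensoringRight (ModuleCat.{u} S)).map (mulHom S T r)) _).app
    P.complex

/-- The cycles of `P ⊗_S T`, as an `R`-submodule. -/
noncomputable def tensorCycles (i : ℕ) : Submodule R (tensorOver (P.complex.X i) T) where
  carrier := {z | ((tensorComplex P T).d i ((ComplexShape.down ℕ).next i)).hom z = 0}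
  add_mem' := fun {z z'} h h' => (map_add ((tensorComplex P T).d i _).hom z z').trans
    ((congrArg₂ (· + ·) h h').trans (add_zero _))
  zero_mem' := map_zero _
  smul_mem' := fun r z h => by
    change ((tensorComplex P T).d i ((ComplexShape.down ℕ).next i)).hom
      (((mulTensor P T r).f i).hom z) = 0
    exact (ConcreteCategory.congr_hom
      ((mulTensor P T r).comm i ((ComplexShape.down ℕ).next i)) z).trans
      ((congrArg ((mulTensor P T r).f _).hom h).trans (map_zero _))

/-- The map sending a cycle of `P ⊗_S T` to its class in `Tor`. -/
noncomputable def torClass (i : ℕ) :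
    LinearMap.ker ((tensorComplex P T).d i ((ComplexShape.down ℕ).next i)).hom →ₗ[S]
      ((Tor' (ModuleCat.{u} S) i).obj X).obj (restrict S T) :=
  (P.isoLeftDerivedObj ((tensoringRight (ModuleCat.{u} S)).obj (restrict S T)) i).inv.hom.comp
    (homologyClass (tensorComplex P T) i)

theorem map_mulHom_torClass {i : ℕ} (r : R)
    (z z' : LinearMap.ker ((tensorComplex P T).d i ((ComplexShape.down ℕ).next i)).hom)
    (h : ((mulTensor P T r).f i).hom z.1 = z'.1) :
    torClass P T i z' =
      (((Tor' (ModuleCat.{u} S) i).obj X).map (mulHom S T r)).hom (torClass P T i z) := by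
  have h1 := P.leftDerived_app_eq ((tensoringRight (ModuleCat.{u} S)).map (mulHom S T r)) i
  rw [← Iso.inv_comp_eq] at h1
  have h2 := ConcreteCategory.congr_hom h1 (homologyClass (tensorComplex P T) i z)
  refine Eq.trans ?_ h2.symm
  exact congrArg (P.isoLeftDerivedObj ((tensoringRight (ModuleCat.{u} S)).obj
    (restrict S T)) i).inv.hom (homologyMap_homologyClass (mulTensor P T r) i z z' h).symm

/-- The `R`-linear map to an induced module given by an additive map commuting with the action. -/
noncomputable def toInducedModule (F : ModuleCat.{u} S ⥤ ModuleCat.{u} S) [F.Additive]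
    {M : Type*} [AddCommGroup M] [Module R M] (g : M → F.obj (restrict S T))
    (hg : ∀ x y, g (x + y) = g x + g y)
    (hg' : ∀ (r : R) x, g (r • x) = (F.map (mulHom S T r)).hom (g x)) :
    M →ₗ[R] inducedModule F T where
  toFun := g
  map_add' := hg
  map_smul' := hg'

theorem smul_val_tensorCycles {i : ℕ} (r : R) (z : tensorCycles P T i) :
    ((mulTensor P T r).f i).hom z.1 = (r • z).1 := rfl

/-- A cycle of `P ⊗_S T` regarded as an element of the kernel of the differential. -/
noncomputable def tensorCycles.toKer {i : ℕ} (z : tensorCycles P T i) :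
    LinearMap.ker ((tensorComplex P T).d i ((ComplexShape.down ℕ).next i)).hom :=
  ⟨z.1, z.2⟩

theorem tensorCycles.toKer_add {i : ℕ} (z z' : tensorCycles P T i) :
    toKer P T (z + z') = toKer P T z + toKer P T z' := rfl

theorem torClass_add {i : ℕ} (z z' : tensorCycles P T i) :
    torClass P T i (tensorCycles.toKer P T (z + z')) =
      torClass P T i (tensorCycles.toKer P T z) + torClass P T i (tensorCycles.toKer P T z') := by
  rw [tensorCycles.toKer_add, map_add]

theorem torClass_smul {i : ℕ} (r : R) (z : tensorCycles P T i) :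
    torClass P T i (tensorCycles.toKer P T (r • z)) =
      (((Tor' (ModuleCat.{u} S) i).obj X).map (mulHom S T r)).hom
        (torClass P T i (tensorCycles.toKer P T z)) :=
  map_mulHom_torClass P T r _ _ (smul_val_tensorCycles P T r z)

/-- The `R`-linear map sending a cycle of `P ⊗_S T` to its class in `Tor`. -/
noncomputable def torMk (i : ℕ) :
    tensorCycles P T i →ₗ[R] inducedModule ((Tor' (ModuleCat.{u} S) i).obj X) T :=
  toInducedModule T ((Tor' (ModuleCat.{u} S) i).obj X)
    (fun z => torClass P T i (tensorCycles.toKer P T z))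
    (torClass_add P T) (torClass_smul P T)

theorem torMk_surjective (i : ℕ) : Function.Surjective (torMk P T i) := by
  intro y
  let e := P.isoLeftDerivedObj ((tensoringRight (ModuleCat.{u} S)).obj (restrict S T)) i
  obtain ⟨z, hz⟩ := homologyClass_surjective (tensorComplex P T) i (e.hom.hom y)
  exact ⟨⟨z.1, z.2⟩, (congrArg e.inv.hom hz).trans (iso_hom_inv_apply e.symm y)⟩

/-- Trades the action of `s` on `T` for its action on the resolution, where `s ∈ J` lifts the zero
map of `S/J`. -/
theorem whiskerLeft_mulHom_algebraMap (Q : ModuleCat.{u} S) (s : S) :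
    Q ◁ mulHom S T (algebraMap S R s) = (s • 𝟙 Q) ▷ restrict S T := by
  have h : mulHom S T (algebraMap S R s) = s • 𝟙 (restrict S T) := by
    ext t
    rfl
  rw [h, MonoidalLinear.whiskerLeft_smul, MonoidalLinear.smul_whiskerRight,
    MonoidalCategory.whiskerLeft_id, MonoidalCategory.id_whiskerRight]

/-- `Tor_i^S(S/J, T)` is annihilated by `J`. -/
theorem smul_torOver_eq_zero {J : Ideal S} {i : ℕ} {s : S} (hs : s ∈ J) (y : torOver J i T) :
    algebraMap S R s • y = 0 := by
  let P := projectiveResolution (ModuleCat.of S (S ⧸ J))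
  obtain ⟨z, rfl⟩ := torMk_surjective P T i y
  let F := (tensoringRight (ModuleCat.{u} S)).obj (restrict S T)
  -- Both `s • 𝟙` and `0` lift the zero endomorphism of `S/J`, so they induce the same map on Tor.
  have h1 := P.isoLeftDerivedObj_inv_naturality 0 P (s • 𝟙 P.complex) (by
      refine Eq.trans ?_ comp_zero.symm
      ext x
      change (P.π.f 0).hom (s • x) = 0
      rw [map_smul]
      generalize (P.π.f 0).hom x = w
      obtain ⟨t, rfl⟩ := Ideal.Quotient.mk_surjective (show S ⧸ J from w)
      change Ideal.Quotient.mk J (s * t) = 0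
      exact Ideal.Quotient.eq_zero_iff_mem.2 (Ideal.mul_mem_right _ _ hs)) F i
  have h2 := P.isoLeftDerivedObj_inv_naturality 0 P 0
    (by exact Eq.trans zero_comp comp_zero.symm) F i
  rw [h1] at h2
  have h3 := ConcreteCategory.congr_hom h2 (homologyClass (tensorComplex P T) i ⟨z.1, z.2⟩)
  have h4 : (HomologicalComplex.homologyMap ((F.mapHomologicalComplex _).map (s • 𝟙 P.complex))
      i).hom (homologyClass (tensorComplex P T) i ⟨z.1, z.2⟩) =
      homologyClass (tensorComplex P T) i
        ⟨(algebraMap S R s • z).1, (algebraMap S R s • z).2⟩ :=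
    homologyMap_homologyClass _ _ _ _ (ConcreteCategory.congr_hom
      (whiskerLeft_mulHom_algebraMap T (P.complex.X i) s) z.1).symm
  have h5 : (HomologicalComplex.homologyMap ((F.mapHomologicalComplex _).map
      (0 : P.complex ⟶ P.complex)) i).hom (homologyClass (tensorComplex P T) i ⟨z.1, z.2⟩) = 0 := by
    rw [Functor.map_zero, HomologicalComplex.homologyMap_zero]
    rfl
  refine ((torMk P T i).map_smul (algebraMap S R s) z).symm.trans ?_
  refine (congrArg (P.isoLeftDerivedObj F i).inv.hom h4).symm.trans (h3.trans ?_)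
  exact (congrArg (P.isoLeftDerivedObj F i).inv.hom h5).trans (map_zero _)

theorem isArtinian_torOver_of_isMinimax [IsNoetherianRing S] [IsNoetherianRing R] {J : Ideal S}
    {a : Ideal R}
    (h : ∀ P : Ideal R, P.IsPrime → a ≤ P → J.map (algebraMap S R) ≤ P → P.IsMaximal)
    (ha : IsPowTorsion a T) (hT : IsMinimax R T) (i : ℕ) : IsArtinian R (torOver J i T) := by
  obtain ⟨P, hP⟩ := exists_finite_projectiveResolution S (ModuleCat.of S (S ⧸ J))
  obtain ⟨n, f, hf⟩ := exists_surjective_tensorOver (P.complex.X i) T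
  have hinj := (tensorCycles P T i).injective_subtype
  refine IsMinimax.isArtinian (a := a) (I := J.map (algebraMap S R)) h
    ((((hT.pi (Fin n)).of_surjective f hf).of_injective _ hinj).of_surjective (torMk P T i)
      (torMk_surjective P T i))
    ((((ha.pi (Fin n)).of_surjective f hf).of_injective _ hinj).of_surjective (torMk P T i)
      (torMk_surjective P T i)) fun y => ⟨1, ?_⟩
  rw [forall_mem_map_pow_smul_eq_zero_iff]
  intro x hx
  rw [pow_one] at hx
  exact smul_torOver_eq_zero T hx y

end Tor

/-! ### Ideals of the graded ring containing the irrelevant ideal. -/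

section Graded

variable {R : Type u} [CommRing R] (𝒜 : ℕ → AddSubgroup R) [GradedRing 𝒜]

theorem sub_projZero_mem_irrelevant (r : R) :
    r - algebraMap (𝒜 0) R (GradedRing.projZeroRingHom' 𝒜 r) ∈
      (HomogeneousIdeal.irrelevant 𝒜).toIdeal := by
  rw [HomogeneousIdeal.toIdeal_irrelevant, RingHom.mem_ker, map_sub, sub_eq_zero]
  change _ = GradedRing.projZeroRingHom 𝒜 ((GradedRing.projZeroRingHom' 𝒜 r : 𝒜 0) : R)
  rw [← GradedRing.coe_projZeroRingHom'_apply, ← GradedRing.coe_projZeroRingHom'_apply,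
    GradedRing.projZeroRingHom'_apply_coe]

variable {𝒜}

/-- Modulo `R₊`, every element equals its degree-zero component. -/
theorem mk_comp_algebraMap_surjective {P : Ideal R}
    (hP : (HomogeneousIdeal.irrelevant 𝒜).toIdeal ≤ P) :
    Function.Surjective ((Ideal.Quotient.mk P).comp (algebraMap (𝒜 0) R)) := by
  intro x
  obtain ⟨r, rfl⟩ := Ideal.Quotient.mk_surjective x
  exact ⟨GradedRing.projZeroRingHom' 𝒜 r,
    (Ideal.Quotient.eq.2 (hP (sub_projZero_mem_irrelevant 𝒜 r))).symm⟩

/-- An ideal containing `R₊` is maximal if and only if its contraction to `R₀` is. -/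
theorem isMaximal_iff_comap_isMaximal {P : Ideal R}
    (hP : (HomogeneousIdeal.irrelevant 𝒜).toIdeal ≤ P) :
    P.IsMaximal ↔ (P.comap (algebraMap (𝒜 0) R)).IsMaximal := by
  have hs := mk_comp_algebraMap_surjective hP
  have hk : RingHom.ker ((Ideal.Quotient.mk P).comp (algebraMap (𝒜 0) R)) =
      P.comap (algebraMap (𝒜 0) R) := by
    rw [← RingHom.comap_ker, Ideal.mk_ker]
  rw [← hk, Ideal.Quotient.maximal_ideal_iff_isField_quotient,
    Ideal.Quotient.maximal_ideal_iff_isField_quotient]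
  let e := (RingHom.quotientKerEquivOfSurjective hs).toMulEquiv
  exact ⟨fun h => e.isField h, fun h => e.symm.isField h⟩

variable [IsLocalRing (𝒜 0)] {a₀ b₀ : Ideal (𝒜 0)}

theorem isMaximal_of_extendAddIrrelevant_le
    (hab : (a₀ + b₀).radical = IsLocalRing.maximalIdeal (𝒜 0)) {P : Ideal R} (hP : P.IsPrime)
    (ha : extendAddIrrelevant 𝒜 a₀ ≤ P) (hb : b₀.map (algebraMap (𝒜 0) R) ≤ P) :
    P.IsMaximal := by
  obtain ⟨ha, hi⟩ := sup_le_iff.1 ha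
  rw [isMaximal_iff_comap_isMaximal hi]
  have hp : (P.comap (algebraMap (𝒜 0) R)).IsPrime := hP.comap _
  have h : (a₀ + b₀).radical ≤ P.comap (algebraMap (𝒜 0) R) := hp.radical_le_iff.2
    (sup_le (Ideal.map_le_iff_le_comap.1 ha) (Ideal.map_le_iff_le_comap.1 hb))
  rw [hab] at h
  rw [← (IsLocalRing.maximalIdeal.isMaximal (𝒜 0)).eq_of_le hp.ne_top h]
  exact IsLocalRing.maximalIdeal.isMaximal _

/-- The contraction of `P` is maximal in the local ring `R₀`, so it is `√(a₀ + b₀)`, which contains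
`b₀`. -/
theorem map_le_of_isMaximal (hab : (a₀ + b₀).radical = IsLocalRing.maximalIdeal (𝒜 0))
    {P : Ideal R} (hP : P.IsMaximal) (ha : extendAddIrrelevant 𝒜 a₀ ≤ P) :
    b₀.map (algebraMap (𝒜 0) R) ≤ P := by
  rw [Ideal.map_le_iff_le_comap, IsLocalRing.eq_maximalIdeal
    ((isMaximal_iff_comap_isMaximal (le_sup_right.trans ha)).1 hP), ← hab]
  exact le_sup_right.trans Ideal.le_radical

end Graded

end GradedMinimax

theorem theorem4p1 {R : Type u} [CommRing R] [IsNoetherianRing R]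
    (𝒜 : ℕ → AddSubgroup R) [GradedRing 𝒜] [IsLocalRing (𝒜 0)]
    (a₀ b₀ : Ideal (𝒜 0))
    (hab : (a₀ + b₀).radical = IsLocalRing.maximalIdeal (𝒜 0))
    {T : Type u} [AddCommGroup T] [Module R T]
    (ℳ : ℤ → AddSubgroup T) (hT : GradedMinimax.IsGradedModule 𝒜 ℳ)
    (htors : GradedMinimax.IsPowTorsion (GradedMinimax.extendAddIrrelevant 𝒜 a₀) T)
    (hmin : GradedMinimax.IsMinimax R T) (i : ℕ) :
    IsArtinian R (GradedMinimax.localCohomologyOver b₀ i (ModuleCat.of R T)) ∧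
    IsArtinian R
      ((localCohomology (b₀.map (algebraMap (𝒜 0) R)) i).obj (ModuleCat.of R T)) ∧
    IsArtinian R (GradedMinimax.torOver b₀ i (ModuleCat.of R T)) := by
  have h := fun (P : Ideal R) (hP : P.IsPrime) =>
    GradedMinimax.isMaximal_of_extendAddIrrelevant_le (𝒜 := 𝒜) hab hP
  have h' := fun (P : Ideal R) (hP : P.IsMaximal) =>
    GradedMinimax.map_le_of_isMaximal (𝒜 := 𝒜) hab hP
  -- For cohomology formed over `R`, the general result is applied with `S = R` and the ideal `b₀R`,
  -- whose extension along the identity is itself.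
  have hid : (b₀.map (algebraMap (𝒜 0) R)).map (algebraMap R R) = b₀.map (algebraMap (𝒜 0) R) :=
    Ideal.map_id _
  refine ⟨GradedMinimax.isArtinian_localCohomologyOver_of_isMinimax h h' htors hmin i,
    GradedMinimax.isArtinian_localCohomology_of_localCohomologyOver
      (GradedMinimax.isArtinian_localCohomologyOver_of_isMinimax (by rwa [hid]) (by rwa [hid])
        htors hmin i),
    GradedMinimax.isArtinian_torOver_of_isMinimax _ h htors hmin i⟩
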